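/- Let $\mathscr P=\{\mathscr P_{n,\pm}\}_{n\ge 0}$ be a (shaded) $C^*$-planar algebra: a planar $*$-algebra in which every $\mathscr P_{n,\pm}$ is a finite-dimensional $C^*$-algebra, together with linear functionals $tr_{0,\pm}$ on $\mathscr P_{0,\pm}$ such that the unnormalized traces $tr_{n,\pm}(x)=tr_{0,\pm}(\mathrm{cl}(x))$ are positive and faithful for all $n$. Here $\mathrm{cl}(x)\in\mathscr P_{0,\pm}$ is obtained by closing up the $n$ strings of $x$ on the right. In $\mathscr P_{n,\pm}$ the leftmost region has shading $\pm$; the product is vertical composition. For $x\in\mathscr P_{2,+}$ let $\widehat x\in\mathscr P_{2,-}$ be its Fourier transform (one-click, i.e. $90^\circ$, clockwise rotation). For 1- or 2-boxes $u,v$ with matching shadings (at least one of them a 2-box), $u*v$ denotes the convolution, obtained by placing $u$ to the left of $v$ and joining the rightmost string of $u$ to the leftmost string of $v$ above and below. So $*$ defines maps $\mathscr P_{2,-}\times\mathscr P_{2,-}\to\mathscr P_{2,-}$, $\mathscr P_{1,+}\times\mathscr P_{2,-}\to\mathscr P_{1,+}$ and $\mathscr P_{2,-}\times\mathscr P_{1,-}\to\mathscr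 P_{1,-}$. For $u\in\mathscr P_{2,-}$, $u^{(*k)}$ is the $k$-th convolution power, $u^{(*0)}$ being the unit of the convolution (the 2-box in which the two top points are joined and the two bottom points are joined). Let $e_1\in\mathscr P_{2,-}$ be the Jones projection, i.e. the range projection of this unit. Let $\mathcal R(y)$ be the range projection of $y$, $\bigvee$ the join of projections, $I$ or $1$ the identity, $\overline p\in\mathscr P_{1,-}$ the $180^\circ$ rotation of $p\in\mathscr P_{1,+}$, $\overline p\otimes q\in\mathscr P_{2,-}$ horizontal juxtaposition ($p,q\in\mathscr P_{1,+}$), $\langle y,z\rangle=tr_{1,+}(z^*y)$ on $\mathscr P_{1,+}$, and $d=\dim\mathscr P_{1,+}$. "$y>0$" for an element $y$ of a $C^*$-algebra means that $y$ is positive and invertible. **Theorem.** Let $x\in\mathscr P_{2,+}$ be $\mathfrak F$-positive, i.e. $\widehat x$ is a positive element of $\mathscr P_{2,-}$, and let $B=\bigvee_{k=0}^\infty\mathcal R\big(\widehat x^{(*k)}\big)$. Then the following statements satisfy $$(1)\Rightarrow(2)\Rightarrow(3)\Leftrightarrow(4)\Leftrightarrow(5)\Leftrightarrow(6)\Leftrightarrow(7)\Leftrightarrow(8)\Leftrightarrow(9).$$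 1. $B=1$ and $\dim\mathscr P_{0,+}=1$. 2. $B=1$ and $tr_{0,+}\big(\mathrm{cl}(p_1)\,\mathrm{cl}(p_2)\big)\ne 0$ for all minimal projections $p_1,p_2\in\mathscr P_{1,+}$. 3. $B(\overline{p_1}\otimes p_2)\neq 0$ for all minimal projections $p_1,p_2\in\mathscr P_{1,+}$. 4. $tr_{2,-}\big(B(\overline{p_1}\otimes p_2)\big)\neq 0$ for all minimal projections $p_1,p_2\in\mathscr P_{1,+}$. 5. $\mathcal R(p*B)=I$ for every nonzero projection $p\in\mathscr P_{1,+}$. 6. $x$ is irreducible on $\mathscr P_{1,+}$: for every projection $p\in\mathscr P_{1,+}$, if $p*\widehat x\le\lambda p$ for some $\lambda>0$, then $p=0$ or $p=I$. 7. $p*(e_1+\widehat x)^{(*(d-1))}>0$ for every nonzero projection $p\in\mathscr P_{1,+}$. 8. For all nonzero positive elements $y_1,y_2\in\mathscr P_{1,+}$ with $\langle y_1,y_2\rangle=0$ there is an integer $0\le k_0<d$ with $\langle y_1*\widehat x^{(*k_0)},y_2\rangle>0$. 9. For every projection $q\in\mathscr P_{1,-}$, if $\widehat x*q\le\lambda q$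 for some $\lambda>0$, then $q=0$ or $q=I$. Moreover, statement (7) with $e_1$ replaced by the unit of the convolution is also equivalent to (3)–(9). -/

import Mathlib

open CategoryTheory CategoryTheory.Bicategory
open scoped ComplexOrder

universe u v w

noncomputable section

/-! ### Order-theoretic notions in a finite-dimensional C*-algebra, read off its `*`-algebra -/

section StarAlgebra

variable {A : Type*} [Ring A] [StarRing A]

/-- `x` is positive: `x = y y*` for some `y`. -/
def IsPos (x : A) : Prop := ∃ y : A, x = y * star y

/-- `x` is strictly positive: positive and invertible. -/
def IsStrictlyPos (x : A) : Prop := IsPos x ∧ IsUnit x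

/-- The C*-algebraic order `x ≤ y`. -/
def PosLE (x y : A) : Prop := IsPos (y - x)

/-- `p` is a least upper bound, among projections, of the projections in `S`. -/
def IsProjJoin (S : Set A) (p : A) : Prop :=
  IsStarProjection p ∧ (∀ q ∈ S, PosLE q p) ∧
    ∀ r : A, IsStarProjection r → (∀ q ∈ S, PosLE q r) → PosLE p r

open Classical in
/-- The join `⋁ S` of a set of projections. -/
def projJoin (S : Set A) : A := if h : ∃ p, IsProjJoin S p then h.choose else 0

/-- `p` is a least projection with `p x = x`. -/
def IsRangeProj (x p : A) : Prop :=
  IsStarProjection p ∧ p * x = x ∧ ∀ q : A, IsStarProjection q → q * x = x → PosLE p q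

open Classical in
/-- The range projection `R(x)`. -/
def rangeProj (x : A) : A := if h : ∃ p, IsRangeProj x p then h.choose else 0

/-- Minimal projections: nonzero, with no projections strictly between `0` and `p`. -/
def IsMinProj (p : A) : Prop :=
  IsStarProjection p ∧ p ≠ 0 ∧ ∀ q : A, IsStarProjection q → PosLE q p → q = 0 ∨ q = p

end StarAlgebra

/-! ### `*`-bicategories over `ℂ` -/

/-- A `ℂ`-linear `*`-structure on a bicategory: whiskering is linear, and every 2-cell
`α : f ⟶ g` has an adjoint `dag α : g ⟶ f` (reflection of diagrams in a horizontal line). -/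
class StarBicategory (B : Type u) [Bicategory.{w, v} B]
    [∀ a b : B, Preadditive (a ⟶ b)] [∀ a b : B, Linear ℂ (a ⟶ b)] where
  whiskerLeft_add : ∀ {a b c : B} (f : a ⟶ b) {g h : b ⟶ c} (α β : g ⟶ h),
    f ◁ (α + β) = f ◁ α + f ◁ β
  whiskerLeft_smul : ∀ {a b c : B} (f : a ⟶ b) {g h : b ⟶ c} (z : ℂ) (α : g ⟶ h),
    f ◁ (z • α) = z • (f ◁ α)
  add_whiskerRight : ∀ {a b c : B} {f g : a ⟶ b} (α β : f ⟶ g) (h : b ⟶ c),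
    (α + β) ▷ h = α ▷ h + β ▷ h
  smul_whiskerRight : ∀ {a b c : B} {f g : a ⟶ b} (z : ℂ) (α : f ⟶ g) (h : b ⟶ c),
    (z • α) ▷ h = z • (α ▷ h)
  dag : ∀ {a b : B} {f g : a ⟶ b}, (f ⟶ g) → (g ⟶ f)
  dag_dag : ∀ {a b : B} {f g : a ⟶ b} (α : f ⟶ g), dag (dag α) = α
  dag_comp : ∀ {a b : B} {f g h : a ⟶ b} (α : f ⟶ g) (β : g ⟶ h),
    dag (α ≫ β) = dag β ≫ dag α
  dag_add : ∀ {a b : B} {f g : a ⟶ b} (α β : f ⟶ g), dag (α + β) = dag α + dag β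
  dag_smul : ∀ {a b : B} {f g : a ⟶ b} (z : ℂ) (α : f ⟶ g),
    dag (z • α) = star z • dag α
  dag_whiskerLeft : ∀ {a b c : B} (f : a ⟶ b) {g h : b ⟶ c} (α : g ⟶ h),
    dag (f ◁ α) = f ◁ dag α
  dag_whiskerRight : ∀ {a b c : B} {f g : a ⟶ b} (α : f ⟶ g) (h : b ⟶ c),
    dag (α ▷ h) = dag α ▷ h
  dag_associator : ∀ {a b c d : B} (f : a ⟶ b) (g : b ⟶ c) (h : c ⟶ d),
    dag (α_ f g h).hom = (α_ f g h).inv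
  dag_leftUnitor : ∀ {a b : B} (f : a ⟶ b), dag (λ_ f).hom = (λ_ f).inv
  dag_rightUnitor : ∀ {a b : B} (f : a ⟶ b), dag (ρ_ f).hom = (ρ_ f).inv

open StarBicategory

section Planar

variable {B : Type u} [Bicategory.{w, v} B]
    [∀ a b : B, Preadditive (a ⟶ b)] [∀ a b : B, Linear ℂ (a ⟶ b)] [StarBicategory B]

/-- The involution on the 2-endomorphisms of a 1-cell. In `End f`, `x * y = y ≫ x`: reading
diagrams from top (source) to bottom (target), `y` is drawn above `x`. -/
instance instStarRingEnd {a b : B} (f : a ⟶ b) : StarRing (End f) where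
  star x := dag (B := B) x
  star_involutive x := dag_dag (B := B) x
  star_mul x y := dag_comp (B := B) y x
  star_add x y := dag_add (B := B) x y

/-- A string `X` together with the same string with the opposite orientation `Y`. The region on
the left of `X` has shading `a`, the region on its right has shading `b`. The units and counits
of the two adjunctions are the four cups and caps, the triangle identities say that
strings may be straightened, and reflection interchanges cups and caps. -/
structure DualPair (a b : B) where
  X : a ⟶ b
  Y : b ⟶ a
  adj : Adjunction X Y
  adj' : Adjunction Y X
  dag_unit : dag adj.unit = adj'.counit
  dag_unit' : dag adj'.unit = adj.counit

namespace DualPair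

variable {a b : B}

/-- The same string seen from the opposite shading. -/
def swap (D : DualPair a b) : DualPair b a where
  X := D.Y
  Y := D.X
  adj := D.adj'
  adj' := D.adj
  dag_unit := D.dag_unit'
  dag_unit' := D.dag_unit

/-- The shading met after crossing `n` strings, starting from `a`. -/
def endShading (a b : B) : ℕ → B
  | 0 => a
  | n + 1 => endShading b a n

/-- `n` parallel strings `X Y X Y ⋯`, leftmost region `a`. -/
def word : {a b : B} → (D : DualPair a b) → (n : ℕ) → (a ⟶ endShading a b n)
  | a, _, _, 0 => 𝟙 a
  | _, _, D, 1 => D.X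
  | _, _, D, n + 2 => D.X ≫ D.swap.word (n + 1)

/-- The `n` parallel strings of `word n`, rotated by 180 degrees. -/
def dualWord : {a b : B} → (D : DualPair a b) → (n : ℕ) → (endShading a b n ⟶ a)
  | a, _, _, 0 => 𝟙 a
  | _, _, D, 1 => D.Y
  | _, _, D, n + 2 => D.swap.dualWord (n + 1) ≫ D.Y

/-- Nested cups and caps, `n` strings turning one way. -/
def wordAdj : {a b : B} → (D : DualPair a b) → (n : ℕ) → Adjunction (D.word n) (D.dualWord n)
  | a, _, _, 0 => Adjunction.id a
  | _, _, D, 1 => D.adj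
  | _, _, D, n + 2 => D.adj.comp (D.swap.wordAdj (n + 1))

/-- Nested cups and caps, `n` strings turning the other way. -/
def wordAdj' : {a b : B} → (D : DualPair a b) → (n : ℕ) → Adjunction (D.dualWord n) (D.word n)
  | a, _, _, 0 => Adjunction.id a
  | _, _, D, 1 => D.adj'
  | _, _, D, n + 2 => (D.swap.wordAdj' (n + 1)).comp D.adj'

/-- The space of `n`-boxes whose leftmost region is `a`. -/
abbrev Box (D : DualPair a b) (n : ℕ) : Type w := End (D.word n)

/-- Closing up an `n`-box on its right. -/
def closure (D : DualPair a b) (n : ℕ) (x : D.Box n) : D.Box 0 :=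
  (D.wordAdj n).unit ≫ x ▷ D.dualWord n ≫ (D.wordAdj' n).counit

/-- The unnormalized trace on `n`-boxes determined by a functional on `0`-boxes. -/
def tr (D : DualPair a b) (τ : D.Box 0 →ₗ[ℂ] ℂ) (n : ℕ) (x : D.Box n) : ℂ :=
  τ (D.closure n x)

/-- Requirements on the `n`-boxes with leftmost region `a`, for all `n`. -/
structure IsCStar (D : DualPair a b) (τ : D.Box 0 →ₗ[ℂ] ℂ) : Prop where
  /-- Rotating a box by 180 degrees clockwise or counterclockwise gives the same result, that is,
  rotation by 360 degrees is the identity. -/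
  pivotal : ∀ (n : ℕ) (x : D.Box n),
    conjugateEquiv (D.wordAdj n) (D.wordAdj n) x =
      (conjugateEquiv (D.wordAdj' n) (D.wordAdj' n)).symm x
  finiteDimensional : ∀ n : ℕ, FiniteDimensional ℂ (D.Box n)
  /-- The `*`-algebra of `n`-boxes is a C*-algebra. -/
  cstar : ∀ n : ℕ, ∃ (A : Type w) (_ : CStarAlgebra A), Nonempty (D.Box n ≃⋆ₐ[ℂ] A)
  /-- The traces are positive and faithful. -/
  tr_pos : ∀ (n : ℕ) (x : D.Box n), x ≠ 0 → 0 < D.tr τ n (star x * x)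

/-! #### Operations on 1-boxes and 2-boxes

By definition `D.Box 1`, `D.swap.Box 1`, `D.Box 2`, `D.swap.Box 2` are the 2-endomorphisms of
`X`, `Y`, `X ≫ Y`, `Y ≫ X`. In the formulas below, the slices of a diagram are listed from top to
bottom. -/

/-- Rotation of a 1-box by 180 degrees. -/
def rot (D : DualPair a b) (p : D.X ⟶ D.X) : D.Y ⟶ D.Y :=
  𝟙 _ ⊗≫ D.Y ◁ D.adj.unit ⊗≫ D.Y ◁ p ▷ D.Y ⊗≫ D.adj.counit ▷ D.Y ⊗≫ 𝟙 _

/-- Horizontal juxtaposition `p ⊗ q` of 1-boxes. -/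
def tensor (D : DualPair a b) (p : D.X ⟶ D.X) (q : D.Y ⟶ D.Y) : D.X ≫ D.Y ⟶ D.X ≫ D.Y :=
  p ▷ D.Y ≫ D.X ◁ q

/-- The Fourier transform: one-click (90 degrees) clockwise rotation of a 2-box. The bottom left
string is bent up to the top left, the top right string is bent down to the bottom right. -/
def fourier (D : DualPair a b) (x : D.X ≫ D.Y ⟶ D.X ≫ D.Y) : D.Y ≫ D.X ⟶ D.Y ≫ D.X :=
  𝟙 _ ⊗≫ (D.Y ≫ D.X) ◁ D.adj'.unit ⊗≫
    D.Y ◁ x ▷ D.X ⊗≫ D.adj.counit ▷ (D.Y ≫ D.X) ⊗≫ 𝟙 _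

/-- The convolution `x * y` of 2-boxes: `x` and `y` side by side, the right string of `x` being
joined to the left string of `y` above and below. -/
def conv (D : DualPair a b) (x y : D.X ≫ D.Y ⟶ D.X ≫ D.Y) : D.X ≫ D.Y ⟶ D.X ≫ D.Y :=
  𝟙 _ ⊗≫ D.X ◁ D.adj'.unit ▷ D.Y ⊗≫
    x ▷ (D.X ≫ D.Y) ⊗≫ (D.X ≫ D.Y) ◁ y ⊗≫
    D.X ◁ D.adj.counit ▷ D.Y ⊗≫ 𝟙 _

/-- The unit of the convolution: the two top points are joined to each other, and so are the two
bottom points (read from the top, a pair of strings is annihilated and then created). -/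
def convUnit (D : DualPair a b) : D.X ≫ D.Y ⟶ D.X ≫ D.Y :=
  D.adj'.counit ≫ D.adj.unit

/-- The Jones projection `e₁`: the projection proportional to `convUnit` when the value of a
closed loop is a scalar, and in general its range projection. -/
def jones (D : DualPair a b) : D.Box 2 := rangeProj (A := D.Box 2) D.convUnit

/-- Convolution powers `x^(*k)`, with `x^(*0)` the unit of the convolution. -/
def convPow (D : DualPair a b) (x : D.X ≫ D.Y ⟶ D.X ≫ D.Y) : ℕ → (D.X ≫ D.Y ⟶ D.X ≫ D.Y)
  | 0 => D.convUnit
  | k + 1 => D.conv (D.convPow x k) x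

/-- `y * u` for a 1-box `y` and a 2-box `u` of the opposite shading: `y` stands on the left of `u`
and its string is joined to the left string of `u` above and below. -/
def convLeft (D : DualPair a b) (y : D.X ⟶ D.X) (u : D.Y ≫ D.X ⟶ D.Y ≫ D.X) : D.X ⟶ D.X :=
  𝟙 _ ⊗≫ D.adj.unit ▷ D.X ⊗≫ y ▷ (D.Y ≫ D.X) ⊗≫
    D.X ◁ u ⊗≫ D.adj'.counit ▷ D.X ⊗≫ 𝟙 _

/-- `u * z` for a 2-box `u` and a 1-box `z` of the same shading: `z` stands on the right of `u`
and its string is joined to the right string of `u` above and below. -/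
def convRight (D : DualPair a b) (u : D.X ≫ D.Y ⟶ D.X ≫ D.Y) (z : D.X ⟶ D.X) : D.X ⟶ D.X :=
  𝟙 _ ⊗≫ D.X ◁ D.adj'.unit ⊗≫ u ▷ D.X ⊗≫
    (D.X ≫ D.Y) ◁ z ⊗≫ D.X ◁ D.adj.counit ⊗≫ 𝟙 _

end DualPair

/-- A (shaded) C*-planar algebra in rectangular form. Planar tangles are cut into horizontal
slices, and the planar algebra is the pivotal 2-category with two regions, generated by one string
and its dual, whose 2-cells are boxes with arbitrarily many strings above and below; the laws of
a bicategory, the triangle identities and invariance under rotation by 360 degrees express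
planar isotopy. `gen.Box n` and `gen.swap.Box n` are the spaces of `n`-boxes `P_{n,+}` and
`P_{n,-}`, with leftmost region `plus` and `minus` respectively. -/
structure CStarPlanarAlgebra (B : Type u) [Bicategory.{w, v} B]
    [∀ a b : B, Preadditive (a ⟶ b)] [∀ a b : B, Linear ℂ (a ⟶ b)] [StarBicategory B] where
  plus : B
  minus : B
  gen : DualPair plus minus
  trPlus : gen.Box 0 →ₗ[ℂ] ℂ
  trMinus : gen.swap.Box 0 →ₗ[ℂ] ℂ
  isCStar_plus : gen.IsCStar trPlus
  isCStar_minus : gen.swap.IsCStar trMinus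

namespace CStarPlanarAlgebra

/-- The box spaces `P_{n,+}`. -/
abbrev P (𝔓 : CStarPlanarAlgebra B) (n : ℕ) : Type w := 𝔓.gen.Box n

/-- The box spaces `P_{n,-}`. -/
abbrev N (𝔓 : CStarPlanarAlgebra B) (n : ℕ) : Type w := 𝔓.gen.swap.Box n

variable (𝔓 : CStarPlanarAlgebra B)

/-- The Fourier transform `x ↦ x̂` from `P_{2,+}` to `P_{2,-}`. -/
def hat (x : 𝔓.P 2) : 𝔓.N 2 := 𝔓.gen.fourier x

/-- `x` in `P_{2,+}` is `𝔉`-positive. -/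
def IsFPositive (x : 𝔓.P 2) : Prop := IsPos (𝔓.hat x)

/-- The convolution `p * u` of `p` in `P_{1,+}` with `u` in `P_{2,-}`. -/
def conv12 (p : 𝔓.P 1) (u : 𝔓.N 2) : 𝔓.P 1 := 𝔓.gen.convLeft p u

/-- The convolution `u * q` of `u` in `P_{2,-}` with `q` in `P_{1,-}`. -/
def conv21 (u : 𝔓.N 2) (q : 𝔓.N 1) : 𝔓.N 1 := 𝔓.gen.swap.convRight u q

/-- The convolution powers in `P_{2,-}`. -/
def pow (u : 𝔓.N 2) (k : ℕ) : 𝔓.N 2 := 𝔓.gen.swap.convPow u k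

/-- The Jones projection in `P_{2,-}`. -/
def e₁ : 𝔓.N 2 := 𝔓.gen.swap.jones

/-- The unit of the convolution on `P_{2,-}`. -/
def unit : 𝔓.N 2 := 𝔓.gen.swap.convUnit

/-- For `p` and `q` in `P_{1,+}`, the element `p̄ ⊗ q` of `P_{2,-}`. -/
def barTensor (p q : 𝔓.P 1) : 𝔓.N 2 := 𝔓.gen.swap.tensor (𝔓.gen.rot p) q

/-- The inner product `⟨y, z⟩ = tr_{1,+}(z* y)` on `P_{1,+}`. -/
def inner (y z : 𝔓.P 1) : ℂ := 𝔓.gen.tr 𝔓.trPlus 1 (star z * y)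

/-- `x` is irreducible on `P_{1,+}`. -/
def IsIrreducible (x : 𝔓.P 2) : Prop :=
  ∀ p : 𝔓.P 1, IsStarProjection p →
    ∀ c : ℝ, 0 < c → PosLE (𝔓.conv12 p (𝔓.hat x)) ((c : ℂ) • p) → p = 0 ∨ p = 1

/-- The join of the range projections of `x̂^(*k)`, over all `k ≥ 0`. -/
def convSupport (x : 𝔓.P 2) : 𝔓.N 2 :=
  projJoin (Set.range fun k : ℕ => rangeProj (𝔓.pow (𝔓.hat x) k))

end CStarPlanarAlgebra

end Planar

end

/-! This is Perron–Frobenius theory for the map `T p = p * x̂` on the finite-dimensional C*-algebra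
`P_{1,+}`. By a diagrammatic Schur product theorem the convolution of positive elements is positive:
a convolution of squares has the form `z z*` with `z` a diagram with unequal numbers of strings
above and below, and bending strings reduces its positivity to that of the traces on 1-, 2- and
3-boxes. Hence `T` is a positive map, and by associativity convolution by `x̂^(*k)` is `T^k`.

Statements (3)–(9) all turn out to say that `T` fixes no proper face of the positive cone. The
preorder `Dominated` (`x ≤ c y` for some `c > 0`) compares range projections of positive elements
without computing them. By finite dimension, `B` is dominated by a finite sum of convolution powers
and dominates each of them, so `p * B` has as support the smallest `T`-invariant projection above
`p` (`dominated_one_iff_isIrreducibleMap`). For irreducible `T` the supports of `(1 + T)^k p` grow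
strictly until they reach `1`, which takes at most `d - 1` steps (`dominated_one_pow`).

The bridge to the 2-box conditions is `trLin_convLeft_eq_zero_iff`: `tr(q (p * u)) = 0` exactly when
`u (p̄ ⊗ q) = 0`. Its mirror image `trLin_convRightSwap_eq_zero_iff` leads to the same 2-box
equation for convolution on the other side, which gives (9). The case `u = 1` gives (2) ⇒ (3). -/

/-- Finite-dimensional `*`-algebras over `ℂ` that are C*-algebras. -/
structure IsFDCStar (A : Type w) [Ring A] [StarRing A] [Algebra ℂ A] : Prop where
  finiteDimensional : FiniteDimensional ℂ A
  cstar : ∃ (C : Type w) (_ : CStarAlgebra C), Nonempty (A ≃⋆ₐ[ℂ] C)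

/-- A faithful positive tracial functional on a `*`-algebra. -/
structure IsFaithfulTrace {A : Type*} [Ring A] [StarRing A] [Algebra ℂ A] (τ : A →ₗ[ℂ] ℂ) :
    Prop where
  comm : ∀ x y : A, τ (x * y) = τ (y * x)
  pos : ∀ x : A, x ≠ 0 → 0 < τ (star x * x)

/-! ### Positivity and functional calculus in a finite-dimensional C*-algebra. -/

section StarRing

variable {A : Type*} [Ring A] [StarRing A]

lemma IsPos.isSelfAdjoint {x : A} (h : IsPos x) : star x = x := by
  obtain ⟨y, rfl⟩ := h; simp

lemma isPos_zero : IsPos (0 : A) := ⟨0, by simp⟩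

lemma isPos_mul_star (y : A) : IsPos (y * star y) := ⟨y, rfl⟩

lemma IsPos.conj {a : A} (h : IsPos a) (b : A) : IsPos (b * a * star b) := by
  obtain ⟨y, rfl⟩ := h; exact ⟨b * y, by simp [mul_assoc]⟩

lemma IsStarProjection.isPos {p : A} (h : IsStarProjection p) : IsPos p :=
  ⟨p, by rw [h.isSelfAdjoint.star_eq, h.isIdempotentElem.eq]⟩

lemma PosLE.refl (x : A) : PosLE x x := by simpa [PosLE] using isPos_zero

lemma posLE_of_mul_eq {p q : A} (hp : IsStarProjection p) (hq : IsStarProjection q)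
    (h : q * p = p) : PosLE p q := by
  have h' : p * q = p := by
    have := congrArg star h
    simpa [hp.isSelfAdjoint.star_eq, hq.isSelfAdjoint.star_eq] using this
  refine ⟨q - p, ?_⟩
  simp [hp.isSelfAdjoint.star_eq, hq.isSelfAdjoint.star_eq, sub_mul, mul_sub, h, h',
    hp.isIdempotentElem.eq, hq.isIdempotentElem.eq]

end StarRing

namespace IsFDCStar

variable {A : Type w} [Ring A] [StarRing A] [Algebra ℂ A]

lemma star_smul (hA : IsFDCStar A) (c : ℂ) (x : A) : star (c • x) = star c • star x := by
  obtain ⟨C, _, ⟨e⟩⟩ := hA.cstar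
  apply EquivLike.injective e
  rw [map_star, map_smul, StarModule.star_smul, map_smul, map_star]

open CStarAlgebra in
lemma exists_order (hA : IsFDCStar A) :
    ∃ (C : Type w) (_ : CStarAlgebra C) (_ : PartialOrder C) (_ : StarOrderedRing C)
      (e : A ≃⋆ₐ[ℂ] C), ∀ x, IsPos x ↔ 0 ≤ e x := by
  obtain ⟨C, hC, ⟨e⟩⟩ := hA.cstar
  refine ⟨C, hC, spectralOrder C, spectralOrderedRing C, e, fun x => ?_⟩
  let _ := spectralOrder C
  have := spectralOrderedRing C
  rw [CStarAlgebra.nonneg_iff_eq_mul_star_self]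
  constructor
  · rintro ⟨y, rfl⟩
    exact ⟨e y, by rw [map_mul, map_star]⟩
  · rintro ⟨b, hb⟩
    refine ⟨e.symm b, EquivLike.injective e ?_⟩
    rw [hb, map_mul, map_star, StarAlgEquiv.apply_symm_apply]

lemma add (hA : IsFDCStar A) {x y : A} (hx : IsPos x) (hy : IsPos y) : IsPos (x + y) := by
  obtain ⟨C, _, _, _, e, he⟩ := hA.exists_order
  rw [he] at *
  rw [map_add]; exact add_nonneg hx hy

lemma antisymm (hA : IsFDCStar A) {x : A} (hx : IsPos x) (hy : IsPos (-x)) : x = 0 := by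
  obtain ⟨C, _, _, _, e, he⟩ := hA.exists_order
  rw [he] at *
  rw [map_neg, Left.nonneg_neg_iff] at hy
  exact EquivLike.injective e (by rw [map_zero]; exact le_antisymm hy hx)

lemma smul (hA : IsFDCStar A) {x : A} (hx : IsPos x) {c : ℝ} (hc : 0 ≤ c) :
    IsPos ((c : ℂ) • x) := by
  obtain ⟨y, rfl⟩ := hx
  refine ⟨((√c : ℝ) : ℂ) • y, ?_⟩
  rw [hA.star_smul, smul_mul_smul_comm]
  congr 1
  simp only [RCLike.star_def, Complex.conj_ofReal]
  norm_cast
  rw [Real.mul_self_sqrt hc]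

lemma sum (hA : IsFDCStar A) {ι : Type*} (s : Finset ι) {f : ι → A} (h : ∀ i ∈ s, IsPos (f i)) :
    IsPos (∑ i ∈ s, f i) :=
  Finset.sum_induction f IsPos (fun _ _ => hA.add) isPos_zero h

lemma star_mul_self_eq_zero (hA : IsFDCStar A) {x : A} (h : star x * x = 0) : x = 0 := by
  obtain ⟨C, _, ⟨e⟩⟩ := hA.cstar
  apply EquivLike.injective e
  have := congrArg e h
  rw [map_mul, map_star, map_zero, CStarRing.star_mul_self_eq_zero_iff] at this
  rw [this, map_zero]

lemma mul_star_self_eq_zero (hA : IsFDCStar A) {x : A} (h : x * star x = 0) : x = 0 := by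
  have := hA.star_mul_self_eq_zero (x := star x) (by simpa using h)
  simpa using congrArg star this

/-- The element `n` is the negative part of `a`. The relation `n a = -n²` expresses orthogonality to
the positive part. -/
lemma exists_negPart (hA : IsFDCStar A) {a : A} (ha : star a = a) :
    ∃ n : A, IsPos n ∧ n * a = -(n * n) ∧ IsPos (a + n) := by
  obtain ⟨C, _, _, _, e, he⟩ := hA.exists_order
  have hs : IsSelfAdjoint (e a) := by
    rw [IsSelfAdjoint, ← map_star, ha]
  have h1 := CFC.posPart_sub_negPart (e a) hs
  have h2 : (e a)⁻ * (e a) = -((e a)⁻ * (e a)⁻) := by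
    nth_rw 2 [← h1]
    rw [mul_sub, CFC.negPart_mul_posPart, zero_sub]
  refine ⟨e.symm ((e a)⁻), ?_, ?_, ?_⟩
  · rw [he]; simpa using CFC.negPart_nonneg (e a)
  · apply EquivLike.injective e
    rw [map_mul, map_neg, map_mul, StarAlgEquiv.apply_symm_apply, h2]
  · rw [he, map_add]
    simp only [StarAlgEquiv.apply_symm_apply]
    rw [← eq_add_of_sub_eq h1]
    exact CFC.posPart_nonneg (e a)

/-- Complex spectral values are roots of the minimal polynomial. Finiteness makes every function
continuous on the spectrum, so indicators and inverses enter the functional calculus. -/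
lemma finite_spectrum (hA : IsFDCStar A) {C : Type*} [CStarAlgebra C] (e : A ≃⋆ₐ[ℂ] C) (a : C) :
    (spectrum ℝ a).Finite := by
  have := hA.finiteDimensional
  have : FiniteDimensional ℂ C := LinearEquiv.finiteDimensional (e.toAlgEquiv.toLinearEquiv)
  have h2 : (spectrum ℂ a).Finite := by
    have hint := (Algebra.IsIntegral.isIntegral (R := ℂ) a)
    refine ((minpoly ℂ a).roots.toFinset.finite_toSet).subset fun z hz => ?_
    have := spectrum.subset_polynomial_aeval a (minpoly ℂ a) ⟨z, hz, rfl⟩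
    rw [minpoly.aeval] at this
    simp only [Finset.mem_coe, Multiset.mem_toFinset, Polynomial.mem_roots', ne_eq]
    refine ⟨minpoly.ne_zero hint, ?_⟩
    by_contra hne
    have hne' : Polynomial.eval z (minpoly ℂ a) ≠ 0 := hne
    apply this
    rw [spectrum.mem_resolventSet_iff, sub_zero]
    exact (Ne.isUnit hne').map (algebraMap ℂ C)
  rw [← spectrum.preimage_algebraMap ℂ]
  exact h2.preimage (algebraMap ℝ ℂ).injective.injOn

lemma exists_support (hA : IsFDCStar A) {a : A} (ha : IsPos a) :
    ∃ p : A, IsStarProjection p ∧ p * a = a ∧ (∃ b, a * b = p) ∧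
      (∃ c : ℝ, 0 < c ∧ PosLE ((c : ℂ) • p) a) ∧ ∃ c : ℝ, 0 < c ∧ PosLE a ((c : ℂ) • p) := by
  obtain ⟨C, _, _, _, e, he⟩ := hA.exists_order
  have hs : IsSelfAdjoint (e a) := by
    rw [IsSelfAdjoint, ← map_star, ha.isSelfAdjoint]
  have hfin := hA.finite_spectrum e (e a)
  have hc : ∀ f : ℝ → ℝ, ContinuousOn f (spectrum ℝ (e a)) := fun f => hfin.continuousOn f
  have hnn : ∀ x ∈ spectrum ℝ (e a), 0 ≤ x := fun x hx =>
    spectrum_nonneg_of_nonneg ((he a).1 ha) hx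
  have hid : cfc (fun x : ℝ => x) (e a) = e a := cfc_id' ℝ (e a)
  obtain ⟨c, hc0, hcl⟩ : ∃ c : ℝ, 0 < c ∧ ∀ x ∈ spectrum ℝ (e a), x ≠ 0 → c ≤ x := by
    by_cases hne : (hfin.toFinset.filter (· ≠ 0)).Nonempty
    · refine ⟨(hfin.toFinset.filter (· ≠ 0)).min' hne, ?_, fun x hx h0 => ?_⟩
      · have := Finset.min'_mem _ hne
        simp only [Finset.mem_filter, Set.Finite.mem_toFinset] at this
        exact lt_of_le_of_ne (hnn _ this.1) (Ne.symm this.2)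
      · exact Finset.min'_le _ _ (by simp [hx, h0])
    -- The spectrum lies in `{0}`, so any positive constant serves.
    · refine ⟨1, one_pos, fun x hx h0 => (hne ⟨x, by simp [hx, h0]⟩).elim⟩
  obtain ⟨M, hM0, hM⟩ : ∃ M : ℝ, 0 < M ∧ ∀ x ∈ spectrum ℝ (e a), x ≤ M := by
    obtain ⟨M, hM⟩ := hfin.bddAbove
    exact ⟨max M 1, by positivity, fun x hx => (hM hx).trans (le_max_left _ _)⟩
  set f : ℝ → ℝ := fun x => if x = 0 then 0 else 1 with hf
  have hsm : ∀ c : ℝ, e ((c : ℂ) • e.symm (cfc f (e a))) = cfc (fun x => c * f x) (e a) := by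
    intro c
    rw [map_smul, StarAlgEquiv.apply_symm_apply, cfc_const_mul c f (e a) (hc _), Complex.coe_smul]
  -- The support is the indicator of the nonzero spectrum applied to `a`. Since `0⁻¹ = 0`, the
  -- function `x⁻¹` gives an inverse on the support. The bounds `c` and `M` lie below the nonzero
  -- spectral values and above all of them.
  refine ⟨e.symm (cfc f (e a)), ?_, ?_, ⟨e.symm (cfc (fun x : ℝ => x⁻¹) (e a)), ?_⟩,
    ⟨c, hc0, ?_⟩, ⟨M, hM0, ?_⟩⟩
  · have h1 : IsStarProjection (cfc f (e a)) := by
      refine ⟨?_, cfc_predicate f (e a)⟩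
      rw [IsIdempotentElem, ← cfc_mul f f (e a) (hc _) (hc _)]
      congr 1; ext x; simp [hf]
    refine ⟨?_, ?_⟩
    · rw [IsIdempotentElem, ← map_mul, h1.isIdempotentElem.eq]
    · rw [IsSelfAdjoint, ← map_star, h1.isSelfAdjoint.star_eq]
  · apply EquivLike.injective e
    rw [map_mul, StarAlgEquiv.apply_symm_apply]
    nth_rw 2 3 [← hid]
    rw [← cfc_mul _ _ (e a) (hc _) (hc _)]
    congr 1; ext x; by_cases h : x = 0 <;> simp [hf, h]
  · apply EquivLike.injective e
    rw [map_mul, StarAlgEquiv.apply_symm_apply, StarAlgEquiv.apply_symm_apply]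
    nth_rw 1 [← hid]
    rw [← cfc_mul _ _ (e a) (hc _) (hc _)]
    congr 1; ext x; by_cases h : x = 0 <;> simp [hf, h]
  · rw [PosLE, he, map_sub, sub_nonneg, hsm]
    nth_rw 2 [← hid]
    refine cfc_mono (fun x hx => ?_) (hc _) (hc _)
    by_cases h : x = 0
    · simp [hf, h]
    · simpa [hf, h] using hcl x hx h
  · rw [PosLE, he, map_sub, sub_nonneg, hsm]
    nth_rw 1 [← hid]
    refine cfc_mono (fun x hx => ?_) (hc _) (hc _)
    by_cases h : x = 0
    · simp [hf, h]
    · simpa [hf, h] using hM x hx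

end IsFDCStar

/-! ### The domination preorder, range projections and joins. -/

/-- `x ≤ c y` for some `c > 0`. -/
def Dominated {A : Type*} [Ring A] [StarRing A] [Algebra ℂ A] (x y : A) : Prop :=
  ∃ c : ℝ, 0 < c ∧ PosLE x ((c : ℂ) • y)

namespace IsFDCStar

variable {A : Type w} [Ring A] [StarRing A] [Algebra ℂ A]

lemma posLE_trans (hA : IsFDCStar A) {x y z : A} (h₁ : PosLE x y) (h₂ : PosLE y z) :
    PosLE x z := by
  have := hA.add h₁ h₂
  rwa [add_comm, sub_add_sub_cancel] at this

lemma dominated_refl (x : A) : Dominated x x := ⟨1, one_pos, by simpa using PosLE.refl x⟩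

lemma dominated_trans (hA : IsFDCStar A) {x y z : A} (h₁ : Dominated x y) (h₂ : Dominated y z) :
    Dominated x z := by
  obtain ⟨c, hc, h⟩ := h₁
  obtain ⟨d, hd, h'⟩ := h₂
  refine ⟨c * d, mul_pos hc hd, hA.posLE_trans h ?_⟩
  have := hA.smul h' hc.le
  rwa [smul_sub, smul_smul, ← Complex.ofReal_mul] at this

lemma dominated_of_posLE {x y : A} (h : PosLE x y) : Dominated x y :=
  ⟨1, one_pos, by simpa using h⟩

lemma dominated_add (hA : IsFDCStar A) {x y z : A} (h₁ : Dominated x z) (h₂ : Dominated y z) :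
    Dominated (x + y) z := by
  obtain ⟨c, hc, h⟩ := h₁
  obtain ⟨d, hd, h'⟩ := h₂
  refine ⟨c + d, add_pos hc hd, ?_⟩
  have := hA.add h h'
  rw [PosLE]
  convert this using 1
  rw [Complex.ofReal_add, add_smul]; abel

lemma dominated_zero {x : A} (hx : IsPos x) : Dominated 0 x :=
  dominated_of_posLE (by simpa [PosLE] using hx)

lemma dominated_sum (hA : IsFDCStar A) {ι : Type*} {s : Finset ι} {f : ι → A} {z : A}
    (hz : IsPos z) (h : ∀ i ∈ s, Dominated (f i) z) : Dominated (∑ i ∈ s, f i) z :=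
  Finset.sum_induction f (Dominated · z) (fun _ _ => hA.dominated_add) (dominated_zero hz) h

lemma dominated_add_right {x y : A} (hy : IsPos y) : Dominated x (x + y) :=
  dominated_of_posLE (by simpa [PosLE] using hy)

lemma dominated_add_left {x y : A} (hx : IsPos x) : Dominated y (x + y) := by
  rw [add_comm]; exact dominated_add_right hx

lemma dominated_sum_right (hA : IsFDCStar A) {ι : Type*} [DecidableEq ι] {s : Finset ι} {f : ι → A}
    (h : ∀ i ∈ s, IsPos (f i)) {i : ι} (hi : i ∈ s) : Dominated (f i) (∑ i ∈ s, f i) := by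
  rw [← Finset.add_sum_erase s f hi]
  exact dominated_add_right (hA.sum _ fun j hj => h j (Finset.mem_of_mem_erase hj))

lemma dominated_map {A' : Type w} [Ring A'] [StarRing A'] [Algebra ℂ A']
    {T : A →ₗ[ℂ] A'} (hT : ∀ a, IsPos a → IsPos (T a)) {x y : A} (h : Dominated x y) :
    Dominated (T x) (T y) := by
  obtain ⟨c, hc, h⟩ := h
  exact ⟨c, hc, by simpa [PosLE] using hT _ h⟩

/-- Compressing `a ≤ c q` by `1 - q` makes both `(1 - q) a (1 - q)` and its negative positive, so it
vanishes. With `a = y y*` this forces `(1 - q) y = 0`. -/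
lemma mul_eq_of_dominated (hA : IsFDCStar A) {a q : A} (ha : IsPos a) (hq : IsStarProjection q)
    (h : Dominated a q) : q * a = a := by
  obtain ⟨c, hc, h⟩ := h
  have h1 := h.conj (1 - q)
  have h2 := ha.conj (1 - q)
  have hs : star (1 - q) = 1 - q := by simp [hq.isSelfAdjoint.star_eq]
  have h0 : (1 - q) * q = 0 := by rw [sub_mul, one_mul, hq.isIdempotentElem.eq, sub_self]
  have e1 : (1 - q) * ((c : ℂ) • q - a) * star (1 - q) = -((1 - q) * a * star (1 - q)) := by
    rw [mul_sub, mul_smul_comm, h0, smul_zero, zero_sub, neg_mul]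
  rw [e1] at h1
  have h3 := hA.antisymm h2 h1
  obtain ⟨y, rfl⟩ := ha
  have h4 : (1 - q) * y = 0 := hA.mul_star_self_eq_zero (by
    rw [star_mul, ← h3]; simp only [mul_assoc])
  rw [sub_mul, one_mul, sub_eq_zero] at h4
  rw [← mul_assoc, ← h4]

lemma posLE_iff (hA : IsFDCStar A) {p q : A} (hp : IsStarProjection p) (hq : IsStarProjection q) :
    PosLE p q ↔ q * p = p :=
  ⟨fun h => hA.mul_eq_of_dominated hp.isPos hq (dominated_of_posLE h), posLE_of_mul_eq hp hq⟩

lemma posLE_antisymm (hA : IsFDCStar A) {x y : A} (h₁ : PosLE x y) (h₂ : PosLE y x) : x = y := by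
  have := hA.antisymm h₂ (by rw [neg_sub]; exact h₁)
  exact sub_eq_zero.1 this

lemma isRangeProj_iff_eq (hA : IsFDCStar A) {a p : A} (hp : IsRangeProj a p) :
    rangeProj a = p := by
  have h : ∃ p, IsRangeProj a p := ⟨p, hp⟩
  rw [rangeProj, dif_pos h]
  obtain ⟨h1, h2, h3⟩ := h.choose_spec
  exact hA.posLE_antisymm (h3 _ hp.1 hp.2.1) (hp.2.2 _ h1 h2)

/-- A positive element and its range projection dominate each other, so inclusions of ranges become
inequalities that positive maps preserve. -/
lemma rangeProj_spec (hA : IsFDCStar A) {a : A} (ha : IsPos a) :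
    IsStarProjection (rangeProj a) ∧ rangeProj a * a = a ∧ (∃ b, a * b = rangeProj a) ∧
      Dominated (rangeProj a) a ∧ Dominated a (rangeProj a) := by
  obtain ⟨p, h1, h2, ⟨b, h3⟩, ⟨c, hc, h4⟩, h5⟩ := hA.exists_support ha
  have : rangeProj a = p := by
    apply hA.isRangeProj_iff_eq
    refine ⟨h1, h2, fun q hq hqa => posLE_of_mul_eq h1 hq ?_⟩
    rw [← h3, ← mul_assoc, hqa]
  rw [this]
  refine ⟨h1, h2, ⟨b, h3⟩, ⟨c⁻¹, inv_pos.2 hc, ?_⟩, h5⟩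
  have := hA.smul h4 (inv_pos.2 hc).le
  rwa [smul_sub, smul_smul, ← Complex.ofReal_mul, inv_mul_cancel₀ hc.ne', Complex.ofReal_one,
    one_smul] at this

lemma rangeProj_eq_one_iff (hA : IsFDCStar A) {a : A} (ha : IsPos a) :
    rangeProj a = 1 ↔ Dominated 1 a := by
  obtain ⟨h1, h2, h3, h4, h5⟩ := hA.rangeProj_spec ha
  constructor
  · intro h; rwa [h] at h4
  · intro h
    have := hA.mul_eq_of_dominated (IsStarProjection.one (R := A)).isPos h1 (hA.dominated_trans h h5)
    rwa [mul_one] at this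

lemma isStrictlyPos_iff (hA : IsFDCStar A) {a : A} (ha : IsPos a) :
    IsStrictlyPos a ↔ Dominated 1 a := by
  obtain ⟨h1, h2, ⟨b, h3⟩, -⟩ := hA.rangeProj_spec ha
  rw [← hA.rangeProj_eq_one_iff ha]
  constructor
  · rintro ⟨-, hu⟩
    exact hu.mul_right_cancel (by rw [h2, one_mul])
  · intro h
    rw [h] at h3
    have h4 : star b * a = 1 := by
      have := congrArg star h3
      rwa [star_mul, star_one, ha.isSelfAdjoint] at this
    exact ⟨ha, isUnit_iff_exists_and_exists.2 ⟨⟨b, h3⟩, ⟨_, h4⟩⟩⟩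

/-- The dimension of the right ideal `pA` serves as a rank, bounding chains of projections by `dim
A`. Equal ideals would give `p q = q`, hence `p = q` on taking adjoints. -/
lemma finrank_lt (hA : IsFDCStar A) {p q : A} (hp : IsStarProjection p) (hq : IsStarProjection q)
    (h : q * p = p) (hne : p ≠ q) :
    Module.finrank ℂ (LinearMap.range (LinearMap.mulLeft ℂ p)) <
      Module.finrank ℂ (LinearMap.range (LinearMap.mulLeft ℂ q)) := by
  have := hA.finiteDimensional
  apply Submodule.finrank_lt_finrank_of_lt
  refine lt_of_le_of_ne ?_ fun heq => hne ?_
  · rintro _ ⟨x, rfl⟩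
    exact ⟨p * x, by simp [← mul_assoc, h]⟩
  · have : q ∈ LinearMap.range (LinearMap.mulLeft ℂ p) := by
      rw [heq]; exact ⟨1, by simp⟩
    obtain ⟨x, hx⟩ := this
    have hpq : p * q = q := by
      rw [← hx, LinearMap.mulLeft_apply, ← mul_assoc, hp.isIdempotentElem.eq]
    have := congrArg star hpq
    rw [star_mul, hp.isSelfAdjoint.star_eq, hq.isSelfAdjoint.star_eq, h] at this
    exact this

lemma exists_isMinProj (hA : IsFDCStar A) {p : A} (hp : IsStarProjection p) (hp0 : p ≠ 0) :
    ∃ q, IsMinProj q ∧ p * q = q := by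
  induction hn : Module.finrank ℂ (LinearMap.range (LinearMap.mulLeft ℂ p)) using
    Nat.strong_induction_on generalizing p with
  | _ n ih =>
    by_cases hmin : IsMinProj p
    · exact ⟨p, hmin, hp.isIdempotentElem.eq⟩
    · have : ∃ q, IsStarProjection q ∧ PosLE q p ∧ q ≠ 0 ∧ q ≠ p := by
        by_contra hcon
        push Not at hcon
        exact hmin ⟨hp, hp0, fun q hq hqp => or_iff_not_imp_left.2 fun h0 => hcon q hq hqp h0⟩
      obtain ⟨q, hq, hqp, h0, hne⟩ := this
      rw [hA.posLE_iff hq hp] at hqp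
      obtain ⟨r, hr, hqr⟩ := ih _ (hn ▸ hA.finrank_lt hq hp hqp hne) hq h0 rfl
      exact ⟨r, hr, by rw [← hqr, ← mul_assoc, hqp]⟩

/-- The join of the range projections of countably many positive elements. -/
lemma projJoin_spec (hA : IsFDCStar A) {x : ℕ → A} (hx : ∀ k, IsPos (x k)) :
    IsStarProjection (projJoin (Set.range fun k => rangeProj (x k))) ∧
      (∀ k, Dominated (x k) (projJoin (Set.range fun k => rangeProj (x k)))) ∧
      ∃ N, Dominated (projJoin (Set.range fun k => rangeProj (x k))) (∑ k ∈ Finset.range N, x k) := by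
  have := hA.finiteDimensional
  set s : ℕ → A := fun N => ∑ k ∈ Finset.range N, x k with hs_def
  have hs : ∀ N, IsPos (s N) := fun N => hA.sum _ fun k _ => hx k
  have hmono : ∀ M N, M ≤ N → Dominated (s M) (s N) := fun M N h => hA.dominated_sum (hs N) fun i hi =>
    hA.dominated_sum_right (fun k _ => hx k)
      (Finset.mem_range.2 ((Finset.mem_range.1 hi).trans_le h))
  have hr := fun N => hA.rangeProj_spec (hs N)
  have hmul : ∀ M N, M ≤ N → rangeProj (s N) * rangeProj (s M) = rangeProj (s M) := fun M N h =>
    hA.mul_eq_of_dominated (hr M).1.isPos (hr N).1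
      (hA.dominated_trans (hr M).2.2.2.1 (hA.dominated_trans (hmono M N h) (hr N).2.2.2.2))
  -- The right ideals generated by the supports of the partial sums form an ascending chain, which
  -- stabilises. The join is therefore the support of one finite partial sum.
  let V : ℕ →o Submodule ℂ A := ⟨fun N => LinearMap.range (LinearMap.mulLeft ℂ (rangeProj (s N))), by
    rintro M N h _ ⟨y, rfl⟩
    exact ⟨rangeProj (s M) * y, by simp [← mul_assoc, hmul M N h]⟩⟩
  obtain ⟨N, hN⟩ := monotone_stabilizes_iff_noetherian.2 (inferInstance : IsNoetherian ℂ A) V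
  have hstab : ∀ M, rangeProj (s N) * rangeProj (s M) = rangeProj (s M) := by
    intro M
    rcases le_total M N with h | h
    · exact hmul M N h
    · have : rangeProj (s M) ∈ V N := by rw [hN M h]; exact ⟨1, by simp⟩
      obtain ⟨y, hy⟩ := this
      rw [LinearMap.mulLeft_apply] at hy
      rw [← hy, ← mul_assoc, (hr N).1.isIdempotentElem.eq]
  have hdom : ∀ k, Dominated (x k) (rangeProj (s N)) := fun k =>
    hA.dominated_trans (hA.dominated_sum_right (s := Finset.range (k + 1)) (fun i _ => hx i)
      (Finset.self_mem_range_succ k))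
      (hA.dominated_trans (hr (k + 1)).2.2.2.2
        (dominated_of_posLE (posLE_of_mul_eq (hr _).1 (hr _).1 (hstab _))))
  have hjoin : IsProjJoin (Set.range fun k => rangeProj (x k)) (rangeProj (s N)) := by
    refine ⟨(hr N).1, ?_, ?_⟩
    · rintro _ ⟨k, rfl⟩
      have hk := hA.rangeProj_spec (hx k)
      exact (hA.posLE_iff hk.1 (hr N).1).2 (hA.mul_eq_of_dominated hk.1.isPos (hr N).1
        (hA.dominated_trans hk.2.2.2.1 (hdom k)))
    · intro q hq h
      refine (hA.posLE_iff (hr N).1 hq).2 (hA.mul_eq_of_dominated (hr N).1.isPos hq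
        (hA.dominated_trans (hr N).2.2.2.1 (hA.dominated_sum hq.isPos fun k _ =>
          hA.dominated_trans (hA.rangeProj_spec (hx k)).2.2.2.2 (dominated_of_posLE (h _ ⟨k, rfl⟩)))))
  have heq : projJoin (Set.range fun k => rangeProj (x k)) = rangeProj (s N) := by
    have h : ∃ p, IsProjJoin (Set.range fun k => rangeProj (x k)) p := ⟨_, hjoin⟩
    rw [projJoin, dif_pos h]
    exact hA.posLE_antisymm (h.choose_spec.2.2 _ hjoin.1 hjoin.2.1)
      (hjoin.2.2 _ h.choose_spec.1 h.choose_spec.2.1)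
  rw [heq]
  exact ⟨(hr N).1, hdom, N, (hr N).2.2.2.1⟩

end IsFDCStar

/-! ### Faithful traces as tests for positivity and domination. -/

namespace IsFaithfulTrace

variable {A : Type w} [Ring A] [StarRing A] [Algebra ℂ A] {τ : A →ₗ[ℂ] ℂ}

lemma nonneg (hτ : IsFaithfulTrace τ) (x : A) : 0 ≤ τ (x * star x) := by
  rw [hτ.comm]
  by_cases h : x = 0
  · simp [h]
  · exact (hτ.pos x h).le

lemma eq_zero (hτ : IsFaithfulTrace τ) {x : A} (h : τ (x * star x) = 0) : x = 0 := by
  by_contra hne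
  have := hτ.pos x hne
  rw [hτ.comm] at h
  exact this.ne' h

lemma nonneg_mul (hτ : IsFaithfulTrace τ) {a b : A} (ha : IsPos a) (hb : IsPos b) :
    0 ≤ τ (a * b) := by
  obtain ⟨x, rfl⟩ := ha
  obtain ⟨y, rfl⟩ := hb
  have := hτ.nonneg (star y * x)
  rw [star_mul, star_star] at this
  rwa [← mul_assoc, ← hτ.comm, ← mul_assoc, ← mul_assoc, mul_assoc]

lemma pos_of_isPos (hτ : IsFaithfulTrace τ) {a : A} (ha : IsPos a) (h0 : a ≠ 0) : 0 < τ a := by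
  obtain ⟨y, rfl⟩ := ha
  refine lt_of_le_of_ne (hτ.nonneg y) fun h => h0 ?_
  rw [hτ.eq_zero h.symm, zero_mul]

lemma le_mul (hτ : IsFaithfulTrace τ) {a a' b : A} (hb : IsPos b) {c : ℝ}
    (h : PosLE a ((c : ℂ) • a')) : τ (a * b) ≤ c * τ (a' * b) := by
  have := hτ.nonneg_mul h hb
  rwa [sub_mul, map_sub, smul_mul_assoc, map_smul, sub_nonneg, smul_eq_mul] at this

lemma eq_zero_of_dominated (hτ : IsFaithfulTrace τ) {a a' b : A} (ha : IsPos a) (hb : IsPos b)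
    (h : Dominated a a') (h0 : τ (a' * b) = 0) : τ (a * b) = 0 := by
  obtain ⟨c, hc, h⟩ := h
  have := hτ.le_mul hb h
  rw [h0, mul_zero] at this
  exact le_antisymm this (hτ.nonneg_mul ha hb)

lemma ne_zero_of_dominated_one (hτ : IsFaithfulTrace τ) {a b : A} (hb : IsPos b) (hb0 : b ≠ 0)
    (h : Dominated 1 a) : τ (a * b) ≠ 0 := by
  intro h0
  have := hτ.eq_zero_of_dominated (IsStarProjection.one (R := A)).isPos hb h h0
  rw [one_mul] at this
  exact (hτ.pos_of_isPos hb hb0).ne' this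

lemma map_conj (hτ : IsFaithfulTrace τ) (x : A) {p : A} (hp : p * p = p) :
    τ (x * p) = τ (p * x * p) := by
  rw [hτ.comm (p * x) p, ← mul_assoc, hp, hτ.comm]

lemma map_mul_eq_zero_iff (hτ : IsFaithfulTrace τ) {p q : A} (hp : IsStarProjection p)
    (hq : IsStarProjection q) : τ (p * q) = 0 ↔ p * q = 0 := by
  refine ⟨fun h => hτ.eq_zero ?_, fun h => by rw [h, map_zero]⟩
  rw [star_mul, hp.isSelfAdjoint.star_eq, hq.isSelfAdjoint.star_eq, ← h, mul_assoc,
    ← mul_assoc q q, hq.isIdempotentElem.eq, hτ.comm, mul_assoc, hp.isIdempotentElem.eq, hτ.comm]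

/-- An element that pairs nonnegatively with positive elements is positive. -/
lemma isPos_of_nonneg (hτ : IsFaithfulTrace τ) (hA : IsFDCStar A) {a : A} (ha : star a = a)
    (h : ∀ b, 0 ≤ τ (b * a * star b)) : IsPos a := by
  obtain ⟨n, hn, h1, h2⟩ := hA.exists_negPart ha
  suffices n = 0 by simpa [this] using h2
  -- Testing against the negative part gives `τ(n a n) = -τ(n³)`. With `n = y y*`, the cube is `(n
  -- y)(n y)*`, so faithfulness forces `n y = 0`.
  have h3 := h n
  rw [h1, hn.isSelfAdjoint] at h3
  obtain ⟨y, hy⟩ := hn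
  have hns : star n = n := by rw [hy]; simp
  have h4 : -(n * n) * n = -((n * y) * star (n * y)) := by
    rw [neg_mul, star_mul, hns]
    nth_rw 2 [hy]
    simp only [mul_assoc]
  rw [h4, map_neg, Left.nonneg_neg_iff] at h3
  have h5 := hτ.eq_zero (le_antisymm h3 (hτ.nonneg _))
  have h6 : n * star n = 0 := by
    rw [hns]; nth_rw 2 [hy]; rw [← mul_assoc, h5, zero_mul]
  exact hA.mul_star_self_eq_zero h6

/-- Criterion for `a ≤ c p`. -/
lemma dominated_iff (hτ : IsFaithfulTrace τ) (hA : IsFDCStar A) {a p : A} (ha : IsPos a)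
    (hp : IsStarProjection p) : Dominated a p ↔ τ (a * (1 - p)) = 0 := by
  have h1 : p * (1 - p) = 0 := by rw [mul_sub, mul_one, hp.isIdempotentElem.eq, sub_self]
  constructor
  · intro h
    exact hτ.eq_zero_of_dominated ha hp.one_sub.isPos h (by rw [h1, map_zero])
  · intro h
    obtain ⟨y, rfl⟩ := ha
    -- By traciality this is the trace of `a (1 - p)`. Faithfulness then gives `p y = y`, which
    -- places the range of `a` below `p`.
    have h2 : τ ((1 - p) * y * star ((1 - p) * y)) = 0 := by
      rw [star_mul, hp.one_sub.isSelfAdjoint.star_eq, mul_assoc, hτ.comm, ← h]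
      simp only [mul_assoc]
      rw [hp.one_sub.isIdempotentElem.eq]
    have h3 := hτ.eq_zero h2
    rw [sub_mul, one_mul, sub_eq_zero] at h3
    obtain ⟨hr, -, ⟨b, hb⟩, -, hd⟩ := hA.rangeProj_spec (isPos_mul_star y)
    refine hA.dominated_trans hd (IsFDCStar.dominated_of_posLE (posLE_of_mul_eq hr hp ?_))
    rw [← hb, ← mul_assoc, ← mul_assoc, ← h3]

end IsFaithfulTrace

/-! ### Perron–Frobenius theory for positive maps. -/

/-- A map is irreducible if it leaves no proper face of the positive cone invariant. -/
def IsIrreducibleMap {A : Type*} [Ring A] [StarRing A] [Algebra ℂ A] (T : A →ₗ[ℂ] A) : Prop :=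
  ∀ p : A, IsStarProjection p → Dominated (T p) p → p = 0 ∨ p = 1

namespace IsFDCStar

variable {A : Type w} [Ring A] [StarRing A] [Algebra ℂ A] {T : A →ₗ[ℂ] A}

lemma isPos_pow (hT : ∀ a, IsPos a → IsPos (T a)) (k : ℕ) {a : A} (ha : IsPos a) :
    IsPos ((T ^ k) a) := by
  induction k with
  | zero => simpa using ha
  | succ k ih => rw [pow_succ', Module.End.mul_apply]; exact hT _ ih

lemma dominated_pow (hA : IsFDCStar A) (hT : ∀ a, IsPos a → IsPos (T a)) {a : A}
    (h : Dominated (T a) a) (k : ℕ) : Dominated ((T ^ k) a) a := by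
  induction k with
  | zero => simpa using dominated_refl a
  | succ k ih =>
    rw [pow_succ', Module.End.mul_apply]
    exact hA.dominated_trans (dominated_map hT ih) h

lemma isPos_one_add (hA : IsFDCStar A) (hT : ∀ a, IsPos a → IsPos (T a)) {a : A} (ha : IsPos a) :
    IsPos ((1 + T) a) := hA.add ha (hT a ha)

lemma ne_zero_of_dominated_one (hA : IsFDCStar A) {p : A} (hp : IsStarProjection p) (hp0 : p ≠ 0) :
    ¬ Dominated p 0 := fun h =>
  hp0 (by simpa using (hA.mul_eq_of_dominated hp.isPos (IsStarProjection.zero (R := A)) h).symm)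

/-- An invariant face is also invariant under `1 + T`, so `1 ≤ c (1 + T)^n p ≤ c' p` for its
projection `p ≠ 0`. -/
lemma isIrreducibleMap_of_pow (hA : IsFDCStar A) (hT : ∀ a, IsPos a → IsPos (T a)) {n : ℕ}
    (h : ∀ p : A, IsStarProjection p → p ≠ 0 → Dominated 1 (((1 + T) ^ n) p)) :
    IsIrreducibleMap T := by
  intro p hp hTp
  refine or_iff_not_imp_left.2 fun h0 => ?_
  have h1 := hA.dominated_pow (T := 1 + T) (fun a => hA.isPos_one_add hT)
    (hA.dominated_add (dominated_refl p) hTp) n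
  have := hA.mul_eq_of_dominated (IsStarProjection.one (R := A)).isPos hp
    (hA.dominated_trans (h p hp h0) h1)
  rwa [mul_one] at this

/-- If `T` is irreducible, then `(1 + T)^(d - 1)` is strictly positive, where `d` is the
dimension. -/
lemma dominated_one_pow (hA : IsFDCStar A) (hT : ∀ a, IsPos a → IsPos (T a))
    (h : IsIrreducibleMap T) {p : A} (hp : IsStarProjection p) (hp0 : p ≠ 0) :
    Dominated 1 (((1 + T) ^ (Module.finrank ℂ A - 1)) p) := by
  have := hA.finiteDimensional
  have : Nontrivial A := ⟨p, 0, hp0⟩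
  set S : A →ₗ[ℂ] A := 1 + T with hS
  have hpos := fun k => isPos_pow (T := S) (fun a => hA.isPos_one_add hT) k hp.isPos
  have hR := fun k => hA.rangeProj_spec (hpos k)
  have hstep : ∀ k, (S ^ (k + 1)) p = (S ^ k) p + T ((S ^ k) p) := fun k => by
    rw [pow_succ', Module.End.mul_apply]; rfl
  have hmono : ∀ k, rangeProj ((S ^ (k + 1)) p) * rangeProj ((S ^ k) p) =
      rangeProj ((S ^ k) p) := fun k =>
    hA.mul_eq_of_dominated (hR k).1.isPos (hR (k + 1)).1 (hA.dominated_trans (hR k).2.2.2.1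
      (hA.dominated_trans (by rw [hstep]; exact dominated_add_right (hT _ (hpos k)))
        (hR (k + 1)).2.2.2.2))
  have h0 : ∀ k, rangeProj ((S ^ k) p) ≠ 0 := by
    intro k
    induction k with
    | zero =>
      intro h0
      have := (hR 0).2.1
      rw [h0, zero_mul] at this
      exact hp0 this.symm
    | succ k ih =>
      intro h0
      have := hmono k
      rw [h0, zero_mul] at this
      exact ih this.symm
  -- The support has rank at least `1` at `k = 0`. If two successive supports agree, that support is
  -- `T`-invariant, so irreducibility makes it `1`; otherwise its rank rises by at least one.
  have key : ∀ k, rangeProj ((S ^ k) p) = 1 ∨ k + 1 ≤ Module.finrank ℂ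
      (LinearMap.range (LinearMap.mulLeft ℂ (rangeProj ((S ^ k) p)))) := by
    intro k
    induction k with
    | zero =>
      right
      have := hA.finrank_lt (IsStarProjection.zero (R := A)) (hR 0).1 (by simp) (h0 0).symm
      omega
    | succ k ih =>
      rcases ih with ih | ih
      · left
        have := hmono k
        rwa [ih, mul_one] at this
      · by_cases heq : rangeProj ((S ^ k) p) = rangeProj ((S ^ (k + 1)) p)
        · left
          rw [← heq]
          refine (h _ (hR k).1 ?_).resolve_left (h0 k)
          refine hA.dominated_trans (dominated_map hT (hR k).2.2.2.1) ?_
          rw [heq]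
          refine hA.dominated_trans ?_ (hR (k + 1)).2.2.2.2
          rw [hstep]
          exact dominated_add_left (hpos k)
        · right
          have := hA.finrank_lt (hR k).1 (hR (k + 1)).1 (hmono k) heq
          omega
  rw [← hA.rangeProj_eq_one_iff (hpos _)]
  -- At `k = d - 1` the rank alternative gives dimension `d`, so the right ideal is all of `A` and
  -- contains `1`.
  refine (key (Module.finrank ℂ A - 1)).elim id fun hfr => ?_
  have htop : LinearMap.range (LinearMap.mulLeft ℂ
      (rangeProj ((S ^ (Module.finrank ℂ A - 1)) p))) = ⊤ := by
    apply Submodule.eq_top_of_finrank_eq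
    have h1 := Module.finrank_pos (R := ℂ) (M := A)
    refine le_antisymm (Submodule.finrank_le _) (by omega)
  obtain ⟨x, hx⟩ := (htop.symm ▸ Submodule.mem_top : (1 : A) ∈ LinearMap.range (LinearMap.mulLeft ℂ
      (rangeProj ((S ^ (Module.finrank ℂ A - 1)) p))))
  rw [LinearMap.mulLeft_apply] at hx
  have := (hR (Module.finrank ℂ A - 1)).1.isIdempotentElem.eq
  calc _ = rangeProj ((S ^ (Module.finrank ℂ A - 1)) p) * 1 := (mul_one _).symm
    _ = 1 := by rw [← hx, ← mul_assoc, this]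

/-- Replacing the identity by an equivalent map in `(1 + T)^n`. -/
lemma dominated_one_pow_iff (hA : IsFDCStar A) {E : A →ₗ[ℂ] A} (hT : ∀ a, IsPos a → IsPos (T a))
    (hE : ∀ a, IsPos a → IsPos (E a)) (h₁ : ∀ a, IsPos a → Dominated (E a) a)
    (h₂ : ∀ a, IsPos a → Dominated a (E a)) (n : ℕ) {p : A} (hp : IsPos p) :
    Dominated 1 (((E + T) ^ n) p) ↔ Dominated 1 (((1 + T) ^ n) p) := by
  have hET : ∀ a, IsPos a → IsPos ((E + T) a) := fun a ha => hA.add (hE a ha) (hT a ha)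
  suffices H : ∀ n, Dominated (((E + T) ^ n) p) (((1 + T) ^ n) p) ∧
      Dominated (((1 + T) ^ n) p) (((E + T) ^ n) p) from
    ⟨fun h => hA.dominated_trans h (H n).1, fun h => hA.dominated_trans h (H n).2⟩
  intro n
  induction n with
  | zero => exact ⟨dominated_refl _, dominated_refl _⟩
  | succ n ih =>
    have hp1 := isPos_pow (T := 1 + T) (fun a => hA.isPos_one_add hT) n hp
    simp only [pow_succ', Module.End.mul_apply]
    refine ⟨hA.dominated_trans (dominated_map hET ih.1) ?_, hA.dominated_trans ?_
      (dominated_map hET ih.2)⟩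
    · simp only [LinearMap.add_apply, Module.End.one_apply]
      refine hA.dominated_add (hA.dominated_trans (h₁ _ hp1) (dominated_add_right (hT _ hp1))) ?_
      exact dominated_add_left hp1
    · simp only [LinearMap.add_apply, Module.End.one_apply]
      refine hA.dominated_add (hA.dominated_trans (h₂ _ hp1) (dominated_add_right (hT _ hp1))) ?_
      exact dominated_add_left (hE _ hp1)

/-- The two bounds identify the support of `E p` with that of a finite orbit sum of `p`, which is
the smallest `T`-invariant projection above `p`. The intended `E` is convolution by `B`. -/
lemma dominated_one_iff_isIrreducibleMap (hA : IsFDCStar A) {E : A →ₗ[ℂ] A}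
    (hT : ∀ a, IsPos a → IsPos (T a)) (hE : ∀ a, IsPos a → IsPos (E a))
    (h₁ : ∀ k a, IsPos a → Dominated ((T ^ k) a) (E a))
    (h₂ : ∃ N, ∀ a, IsPos a → Dominated (E a) (∑ k ∈ Finset.range N, (T ^ k) a)) :
    (∀ p : A, IsStarProjection p → p ≠ 0 → Dominated 1 (E p)) ↔ IsIrreducibleMap T := by
  obtain ⟨N, h₂⟩ := h₂
  constructor
  · intro h p hp hTp
    refine or_iff_not_imp_left.2 fun h0 => ?_
    have := hA.mul_eq_of_dominated (IsStarProjection.one (R := A)).isPos hp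
      (hA.dominated_trans (h p hp h0) (hA.dominated_trans (h₂ p hp.isPos)
        (hA.dominated_sum hp.isPos fun k _ => hA.dominated_pow hT hTp k)))
    rwa [mul_one] at this
  · intro h p hp hp0
    have hR := hA.rangeProj_spec (hE p hp.isPos)
    rw [← hA.rangeProj_eq_one_iff (hE p hp.isPos)]
    refine (h _ hR.1 ?_).resolve_left fun h0 => ?_
    · refine hA.dominated_trans (dominated_map hT (hA.dominated_trans hR.2.2.2.1 (h₂ p hp.isPos))) ?_
      refine hA.dominated_trans ?_ hR.2.2.2.2
      rw [map_sum]
      refine hA.dominated_sum (hE p hp.isPos) fun k _ => ?_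
      rw [← Module.End.mul_apply, ← pow_succ']
      exact h₁ _ _ hp.isPos
    · have := h₁ 0 p hp.isPos
      rw [pow_zero, Module.End.one_apply] at this
      have h2 := hR.2.2.2.2
      rw [h0] at h2
      exact hA.ne_zero_of_dominated_one hp hp0 (hA.dominated_trans this h2)

end IsFDCStar

namespace IsFaithfulTrace

variable {A : Type w} [Ring A] [StarRing A] [Algebra ℂ A] {τ : A →ₗ[ℂ] ℂ} {T : A →ₗ[ℂ] A}

open IsFDCStar

/-- If `E p` lacks full support, a minimal projection below `p` and one below the complement of that
support pair to zero. -/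
lemma dominated_one_iff_isMinProj (hτ : IsFaithfulTrace τ) (hA : IsFDCStar A) {E : A →ₗ[ℂ] A}
    (hE : ∀ a, IsPos a → IsPos (E a)) :
    (∀ p : A, IsStarProjection p → p ≠ 0 → Dominated 1 (E p)) ↔
      ∀ p₁ p₂ : A, IsMinProj p₁ → IsMinProj p₂ → τ (E p₁ * p₂) ≠ 0 := by
  constructor
  · intro h p₁ p₂ h₁ h₂
    exact hτ.ne_zero_of_dominated_one h₂.1.isPos h₂.2.1 (h p₁ h₁.1 h₁.2.1)
  · intro h p hp hp0
    have hR := hA.rangeProj_spec (hE p hp.isPos)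
    rw [← hA.rangeProj_eq_one_iff (hE p hp.isPos)]
    by_contra hne
    obtain ⟨p₁, hp₁, hpp₁⟩ := hA.exists_isMinProj hp hp0
    obtain ⟨p₂, hp₂, hpp₂⟩ := hA.exists_isMinProj hR.1.one_sub (fun h => hne (sub_eq_zero.1 h).symm)
    refine h p₁ p₂ hp₁ hp₂ (hτ.eq_zero_of_dominated (hE _ hp₁.1.isPos) hp₂.1.isPos
      (hA.dominated_trans (dominated_map hE (dominated_of_posLE (posLE_of_mul_eq hp₁.1 hp hpp₁)))
        hR.2.2.2.2) ?_)
    rw [← hpp₂, ← mul_assoc, mul_sub, mul_one, hR.1.isIdempotentElem.eq, sub_self, zero_mul,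
      map_zero]

/-- An invariant projection `p` and its complement `1 - p` are a pair that no power of `T` connects.
-/
lemma isIrreducibleMap_of_exists_pow (hτ : IsFaithfulTrace τ) (hA : IsFDCStar A)
    (hT : ∀ a, IsPos a → IsPos (T a))
    (h : ∀ y₁ y₂ : A, IsPos y₁ → IsPos y₂ → y₁ ≠ 0 → y₂ ≠ 0 → τ (star y₂ * y₁) = 0 →
      ∃ k, k < Module.finrank ℂ A ∧ 0 < τ (star y₂ * (T ^ k) y₁)) :
    IsIrreducibleMap T := by
  intro p hp hTp
  by_contra! hne
  have hs : star (1 - p) = 1 - p := hp.one_sub.isSelfAdjoint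
  have h1 : τ (p * (1 - p)) = 0 := by
    rw [mul_sub, mul_one, hp.isIdempotentElem.eq, sub_self, map_zero]
  obtain ⟨k, -, hk⟩ := h p (1 - p) hp.isPos hp.one_sub.isPos hne.1
    (fun h => hne.2 (sub_eq_zero.1 h).symm) (by rw [hs, hτ.comm, h1])
  rw [hs, hτ.comm, hτ.eq_zero_of_dominated (isPos_pow hT k hp.isPos) hp.one_sub.isPos
    (hA.dominated_pow hT hTp k) h1] at hk
  exact lt_irrefl _ hk

lemma exists_pow_of_isIrreducibleMap (hτ : IsFaithfulTrace τ) (hA : IsFDCStar A)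
    (hT : ∀ a, IsPos a → IsPos (T a)) (h : IsIrreducibleMap T) {y₁ y₂ : A} (h₁ : IsPos y₁)
    (h₂ : IsPos y₂) (hne₁ : y₁ ≠ 0) (hne₂ : y₂ ≠ 0) :
    ∃ k, k < Module.finrank ℂ A ∧ 0 < τ (star y₂ * (T ^ k) y₁) := by
  have := hA.finiteDimensional
  have : Nontrivial A := ⟨y₁, 0, hne₁⟩
  have hd := Module.finrank_pos (R := ℂ) (M := A)
  have hR := hA.rangeProj_spec h₁
  have hR0 : rangeProj y₁ ≠ 0 := fun h0 => hne₁ (by rw [← hR.2.1, h0, zero_mul])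
  have h3 : Dominated 1 (((1 + T) ^ (Module.finrank ℂ A - 1)) y₁) :=
    hA.dominated_trans (hA.dominated_one_pow hT h hR.1 hR0) (dominated_map
      (fun a => isPos_pow (T := 1 + T) (fun a => hA.isPos_one_add hT) _) hR.2.2.2.1)
  have h4 := hτ.ne_zero_of_dominated_one h₂ hne₂ h3
  by_contra! hcon
  -- Since `(1 + T)^(d-1) y₁` dominates `1`, its pairing with `y₂` is nonzero. Its binomial
  -- expansion involves only the powers `k < d`, each pairing nonnegatively, so they cannot all
  -- vanish.
  apply h4
  rw [add_comm, Commute.add_pow (Commute.one_right T)]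
  simp only [one_pow, mul_one, LinearMap.sum_apply, Finset.sum_mul, map_sum]
  refine Finset.sum_eq_zero fun k hk => ?_
  have h5 := hcon k (by have := Finset.mem_range.1 hk; omega)
  rw [h₂.isSelfAdjoint, hτ.comm] at h5
  have h6 := hτ.nonneg_mul (isPos_pow hT k h₁) h₂
  have h7 : τ ((T ^ k) y₁ * y₂) = 0 := by
    by_contra hne
    exact h5 (lt_of_le_of_ne h6 (Ne.symm hne))
  have h8 : ∀ n : ℕ, (n : Module.End ℂ A) y₁ = n • y₁ := fun n => by simp
  rw [Module.End.mul_apply, h8, map_nsmul, smul_mul_assoc, map_nsmul, h7, smul_zero]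

end IsFaithfulTrace

/-! ### Diagram calculus: bending, sliding and closing strings. -/

section Diagrams

namespace StarBicategory

variable {B : Type u} [Bicategory.{w, v} B]
    [∀ a b : B, Preadditive (a ⟶ b)] [∀ a b : B, Linear ℂ (a ⟶ b)] [StarBicategory B]

lemma dag_associator_inv {a b c d : B} (f : a ⟶ b) (g : b ⟶ c) (h : c ⟶ d) :
    dag (α_ f g h).inv = (α_ f g h).hom := by
  rw [← dag_associator, dag_dag]

lemma dag_leftUnitor_inv {a b : B} (f : a ⟶ b) : dag (λ_ f).inv = (λ_ f).hom := by
  rw [← dag_leftUnitor, dag_dag]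

lemma dag_rightUnitor_inv {a b : B} (f : a ⟶ b) : dag (ρ_ f).inv = (ρ_ f).hom := by
  rw [← dag_rightUnitor, dag_dag]

end StarBicategory

open StarBicategory

namespace DualPair

variable {B : Type u} [Bicategory.{w, v} B]
    [∀ a b : B, Preadditive (a ⟶ b)] [∀ a b : B, Linear ℂ (a ⟶ b)] [StarBicategory B]
variable {a b c : B}

lemma dag_counit (D : DualPair a b) : dag D.adj.counit = D.adj'.unit := by
  rw [← D.dag_unit', dag_dag]

/-- Parallel strings. -/
@[simps X Y adj adj']
def comp (D : DualPair a b) (E : DualPair b c) : DualPair a c where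
  X := D.X ≫ E.X
  Y := E.Y ≫ D.Y
  adj := D.adj.comp E.adj
  adj' := E.adj'.comp D.adj'
  dag_unit := by
    -- Explicit associators and unitors let `dag` be pushed through the diagram slice by slice.
    have h : (D.adj.comp E.adj).unit = D.adj.unit ≫ D.X ◁ ((λ_ _).inv ≫ E.adj.unit ▷ D.Y ≫
        (α_ _ _ _).hom) ≫ (α_ _ _ _).inv := by
      simp only [Bicategory.Adjunction.comp_unit, Bicategory.Adjunction.compUnit]; bicategory
    have h' : (E.adj'.comp D.adj').counit = (α_ _ _ _).hom ≫ D.X ◁ ((α_ _ _ _).inv ≫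
        E.adj'.counit ▷ D.Y ≫ (λ_ _).hom) ≫ D.adj'.counit := by
      simp only [Bicategory.Adjunction.comp_counit, Bicategory.Adjunction.compCounit]; bicategory
    rw [h, h']
    simp only [dag_comp, dag_whiskerLeft, dag_whiskerRight, dag_associator, dag_associator_inv,
      dag_leftUnitor_inv, D.dag_unit, E.dag_unit, Category.assoc]
  dag_unit' := by
    have h : (E.adj'.comp D.adj').unit = E.adj'.unit ≫ E.Y ◁ ((λ_ _).inv ≫ D.adj'.unit ▷ E.X ≫
        (α_ _ _ _).hom) ≫ (α_ _ _ _).inv := by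
      simp only [Bicategory.Adjunction.comp_unit, Bicategory.Adjunction.compUnit]; bicategory
    have h' : (D.adj.comp E.adj).counit = (α_ _ _ _).hom ≫ E.Y ◁ ((α_ _ _ _).inv ≫
        D.adj.counit ▷ E.X ≫ (λ_ _).hom) ≫ E.adj.counit := by
      simp only [Bicategory.Adjunction.comp_counit, Bicategory.Adjunction.compCounit]; bicategory
    rw [h, h']
    simp only [dag_comp, dag_whiskerLeft, dag_whiskerRight, dag_associator, dag_associator_inv,
      dag_leftUnitor_inv, D.dag_unit', E.dag_unit', Category.assoc]

/-- Closing up a 2-endomorphism of a string on its right. -/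
def cl (D : DualPair a b) (x : D.X ⟶ D.X) : 𝟙 a ⟶ 𝟙 a :=
  D.adj.unit ≫ x ▷ D.Y ≫ D.adj'.counit

/-- Closing up the right string of a 2-endomorphism. -/
def partialCl (E : DualPair b c) {f : a ⟶ b} (x : f ≫ E.X ⟶ f ≫ E.X) : f ⟶ f :=
  (ρ_ _).inv ≫ f ◁ E.adj.unit ≫ (α_ _ _ _).inv ≫ x ▷ E.Y ≫ (α_ _ _ _).hom ≫
    f ◁ E.adj'.counit ≫ (ρ_ _).hom

lemma cl_comp (D : DualPair a b) (E : DualPair b c) (x : D.X ≫ E.X ⟶ D.X ≫ E.X) :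
    (D.comp E).cl x = D.cl (E.partialCl x) := by
  simp only [cl, partialCl, comp_adj, comp_adj', Bicategory.Adjunction.comp_unit,
    Bicategory.Adjunction.compUnit, Bicategory.Adjunction.comp_counit, Bicategory.Adjunction.compCounit]
  bicategory

/-- Bending the right string of `w` downwards splits the closed loop into a cup belonging to the
bent `w` and a cap belonging to its reflection, so the shape `v v*` survives the partial closure. -/
lemma partialCl_comp_dag (E : DualPair b c) {f : a ⟶ b} {g : a ⟶ c} (w : f ≫ E.X ⟶ g) :
    E.partialCl (w ≫ dag w) = E.adj.homEquiv₂ w ≫ dag (E.adj.homEquiv₂ w) := by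
  simp only [partialCl, Adjunction.homEquiv₂_apply, dag_comp, dag_whiskerLeft, dag_whiskerRight,
    dag_associator_inv, dag_rightUnitor_inv, E.dag_unit, Category.assoc, comp_whiskerRight]

/-- Sliding a box around a cup. -/
lemma unit_comp_whiskerRight (D : DualPair a b) (x : D.X ⟶ D.X) :
    D.adj.unit ≫ x ▷ D.Y = D.adj.unit ≫ D.X ◁ conjugateEquiv D.adj D.adj x := by
  rw [conjugateEquiv_apply']
  symm
  calc
    _ = 𝟙 _ ⊗≫ (D.adj.unit ▷ 𝟙 _ ≫ (D.X ≫ D.Y) ◁ (D.adj.unit ≫ x ▷ D.Y)) ⊗≫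
          D.X ◁ D.adj.counit ▷ D.Y ⊗≫ 𝟙 _ := by bicategory
    _ = 𝟙 _ ⊗≫ D.adj.unit ⊗≫ x ▷ D.Y ⊗≫
          leftZigzag D.adj.unit D.adj.counit ▷ D.Y ⊗≫ 𝟙 _ := by
      rw [← whisker_exchange]; bicategory
    _ = _ := by rw [D.adj.left_triangle]; bicategory

/-- Sliding a box around a cap. -/
lemma whiskerRight_comp_counit (D : DualPair a b) (x : D.X ⟶ D.X) :
    x ▷ D.Y ≫ D.adj'.counit =
      D.X ◁ (conjugateEquiv D.adj' D.adj').symm x ≫ D.adj'.counit := by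
  rw [conjugateEquiv_symm_apply']
  symm
  calc
    _ = 𝟙 _ ⊗≫ D.X ◁ D.adj'.unit ▷ D.Y ⊗≫ ((D.X ≫ D.Y) ◁ (x ▷ D.Y ≫ D.adj'.counit) ≫
          D.adj'.counit ▷ 𝟙 _) ⊗≫ 𝟙 _ := by bicategory
    _ = 𝟙 _ ⊗≫ rightZigzag D.adj'.unit D.adj'.counit ▷ D.Y ⊗≫ x ▷ D.Y ⊗≫ D.adj'.counit := by
      rw [whisker_exchange]; bicategory
    _ = _ := by rw [D.adj'.right_triangle]; bicategory

/-- The box `x` slides around the cap, passes `y` by interchange, and returns around the cup. The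
two rotations it undergoes agree by pivotality, which makes the closure tracial. -/
lemma cl_comp_comm (D : DualPair a b) {x : D.X ⟶ D.X}
    (h : conjugateEquiv D.adj D.adj x = (conjugateEquiv D.adj' D.adj').symm x) (y : D.X ⟶ D.X) :
    D.cl (x ≫ y) = D.cl (y ≫ x) := by
  simp only [cl, comp_whiskerRight, Category.assoc]
  rw [D.whiskerRight_comp_counit x, ← h, ← Category.assoc, D.unit_comp_whiskerRight x,
    Category.assoc, whisker_exchange_assoc]

/-- A cup on the left of a string. -/
def cupLeft (D : DualPair a b) : D.X ⟶ D.X ≫ D.Y ≫ D.X :=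
  (λ_ _).inv ≫ D.adj.unit ▷ D.X ≫ (α_ _ _ _).hom

/-- A cup on the right of a string. -/
def cupRight (D : DualPair a b) : D.Y ⟶ (D.Y ≫ D.X) ≫ D.Y :=
  (ρ_ _).inv ≫ D.Y ◁ D.adj.unit ≫ (α_ _ _ _).inv

/-- A cup between two strings. -/
def cupMiddle (D : DualPair a b) : D.Y ≫ D.X ⟶ (D.Y ≫ D.X) ≫ (D.Y ≫ D.X) :=
  D.Y ◁ ((λ_ _).inv ≫ D.adj.unit ▷ D.X ≫ (α_ _ _ _).hom) ≫ (α_ _ _ _).inv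

/-- The convolution of 2-boxes of the opposite shading. -/
def convSwap (D : DualPair a b) (x y : D.Y ≫ D.X ⟶ D.Y ≫ D.X) : D.Y ≫ D.X ⟶ D.Y ≫ D.X :=
  D.swap.conv x y

/-- The unit of the convolution of 2-boxes of the opposite shading. -/
def convUnitSwap (D : DualPair a b) : D.Y ≫ D.X ⟶ D.Y ≫ D.X := D.swap.convUnit

/-- The convolution with a 1-box of the opposite shading on the right. -/
def convRightSwap (D : DualPair a b) (u : D.Y ≫ D.X ⟶ D.Y ≫ D.X) (z : D.Y ⟶ D.Y) : D.Y ⟶ D.Y :=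
  D.swap.convRight u z

lemma dag_cupLeft (D : DualPair a b) :
    dag D.cupLeft = (α_ _ _ _).inv ≫ D.adj'.counit ▷ D.X ≫ (λ_ _).hom := by
  simp only [cupLeft, dag_comp, dag_whiskerRight, dag_associator, dag_leftUnitor_inv, D.dag_unit,
    Category.assoc]

lemma dag_cupRight (D : DualPair a b) :
    dag D.cupRight = (α_ _ _ _).hom ≫ D.Y ◁ D.adj'.counit ≫ (ρ_ _).hom := by
  simp only [cupRight, dag_comp, dag_whiskerLeft, dag_associator_inv, dag_rightUnitor_inv,
    D.dag_unit, Category.assoc]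

lemma dag_cupMiddle (D : DualPair a b) :
    dag D.cupMiddle = (α_ _ _ _).hom ≫
      D.Y ◁ ((α_ _ _ _).inv ≫ D.adj'.counit ▷ D.X ≫ (λ_ _).hom) := by
  simp only [cupMiddle, dag_comp, dag_whiskerLeft, dag_whiskerRight, dag_associator,
    dag_associator_inv, dag_leftUnitor_inv, D.dag_unit, Category.assoc]

/-- In this form the diagram is symmetric under reflection, apart from the boxes themselves. -/
lemma convLeft_eq (D : DualPair a b) (y : D.X ⟶ D.X) (u : D.Y ≫ D.X ⟶ D.Y ≫ D.X) :
    D.convLeft y u = D.cupLeft ≫ y ▷ (D.Y ≫ D.X) ≫ D.X ◁ u ≫ dag D.cupLeft := by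
  rw [dag_cupLeft, convLeft, cupLeft]
  bicategory

lemma convRightSwap_eq (D : DualPair a b) (u : D.Y ≫ D.X ⟶ D.Y ≫ D.X) (z : D.Y ⟶ D.Y) :
    D.convRightSwap u z = D.cupRight ≫ u ▷ D.Y ≫ (D.Y ≫ D.X) ◁ z ≫ dag D.cupRight := by
  have h : D.convRightSwap u z = 𝟙 _ ⊗≫ D.Y ◁ D.adj.unit ⊗≫ u ▷ D.Y ⊗≫
    (D.Y ≫ D.X) ◁ z ⊗≫ D.Y ◁ D.adj'.counit ⊗≫ 𝟙 _ := rfl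
  rw [dag_cupRight, h, cupRight]
  bicategory

lemma convSwap_eq (D : DualPair a b) (x y : D.Y ≫ D.X ⟶ D.Y ≫ D.X) :
    D.convSwap x y = D.cupMiddle ≫ x ▷ (D.Y ≫ D.X) ≫ (D.Y ≫ D.X) ◁ y ≫ dag D.cupMiddle := by
  have h : D.convSwap x y = 𝟙 _ ⊗≫ D.Y ◁ D.adj.unit ▷ D.X ⊗≫
    x ▷ (D.Y ≫ D.X) ⊗≫ (D.Y ≫ D.X) ◁ y ⊗≫
    D.Y ◁ D.adj'.counit ▷ D.X ⊗≫ 𝟙 _ := rfl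
  rw [dag_cupMiddle, h, cupMiddle]
  bicategory

lemma convUnitSwap_eq (D : DualPair a b) : D.convUnitSwap = D.adj.counit ≫ dag D.adj.counit := by
  rw [dag_counit]; rfl

lemma rot_eq (D : DualPair a b) (p : D.X ⟶ D.X) : D.rot p = conjugateEquiv D.adj D.adj p := by
  rw [conjugateEquiv_apply', rot]
  bicategory

/-- Bending a string is a bijection, so a cup can be cancelled. -/
lemma cupLeft_comp_injective (D : DualPair a b) {s t : D.Y ≫ D.X ⟶ D.Y ≫ D.X}
    (h : D.cupLeft ≫ D.X ◁ s = D.cupLeft ≫ D.X ◁ t) : s = t := by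
  apply (D.adj.homEquiv₁ (g := D.X) (h := D.Y ≫ D.X)).symm.injective
  simpa only [Adjunction.homEquiv₁_symm_apply, cupLeft, Category.assoc] using h

lemma cupRight_comp_injective (D : DualPair a b) {s t : D.Y ≫ D.X ⟶ D.Y ≫ D.X}
    (h : D.cupRight ≫ s ▷ D.Y = D.cupRight ≫ t ▷ D.Y) : s = t := by
  apply (D.adj.homEquiv₂ (g := D.Y) (h := D.Y ≫ D.X)).injective
  simpa only [Adjunction.homEquiv₂_apply, cupRight, Category.assoc] using h

lemma comp_cupLeft (D : DualPair a b) (q : D.X ⟶ D.X) :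
    q ≫ D.cupLeft = D.cupLeft ≫ D.X ◁ D.Y ◁ q := by
  simp only [cupLeft, Category.assoc]
  rw [leftUnitor_inv_naturality_assoc, whisker_exchange_assoc, comp_whiskerLeft]
  simp

lemma comp_cupRight (D : DualPair a b) (q : D.Y ⟶ D.Y) :
    q ≫ D.cupRight = D.cupRight ≫ (q ▷ D.X) ▷ D.Y := by
  simp only [cupRight, Category.assoc]
  rw [rightUnitor_inv_naturality_assoc, ← whisker_exchange_assoc, whiskerRight_comp]
  simp

lemma cupLeft_comp_whiskerRight (D : DualPair a b) (p : D.X ⟶ D.X) :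
    D.cupLeft ≫ p ▷ (D.Y ≫ D.X) = D.cupLeft ≫ D.X ◁ D.rot p ▷ D.X := by
  have h := D.unit_comp_whiskerRight p
  rw [← rot_eq] at h
  simp only [cupLeft, Category.assoc]
  calc _ = (λ_ _).inv ≫ (D.adj.unit ≫ p ▷ D.Y) ▷ D.X ≫ (α_ _ _ _).hom := by bicategory
    _ = _ := by rw [h]; bicategory

lemma cupRight_comp_whiskerLeft (D : DualPair a b) (p : D.X ⟶ D.X) :
    D.cupRight ≫ (D.Y ≫ D.X) ◁ D.rot p = D.cupRight ≫ (D.Y ◁ p) ▷ D.Y := by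
  have h := D.unit_comp_whiskerRight p
  rw [← rot_eq] at h
  simp only [cupRight, Category.assoc]
  symm
  calc _ = (ρ_ _).inv ≫ D.Y ◁ (D.adj.unit ≫ p ▷ D.Y) ≫ (α_ _ _ _).inv := by bicategory
    _ = _ := by rw [h]; bicategory

/-- Two disjoint cups may be created in either order. This interchange underlies the associativity
of convolution. -/
lemma cupLeft_comp_cupLeft (D : DualPair a b) :
    D.cupLeft ≫ D.cupLeft ▷ (D.Y ≫ D.X) ≫ (α_ _ _ _).hom =
      D.cupLeft ≫ D.X ◁ D.cupMiddle := by
  simp only [cupLeft, cupMiddle]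
  calc _ = 𝟙 _ ⊗≫ (𝟙 _ ◁ D.adj.unit ≫ D.adj.unit ▷ (D.X ≫ D.Y)) ▷ D.X ⊗≫ 𝟙 _ := by bicategory
    _ = _ := by rw [whisker_exchange]; bicategory

lemma cupLeft_comp_counit (D : DualPair a b) :
    D.cupLeft ≫ D.X ◁ D.adj.counit = (ρ_ _).inv := by
  simp only [cupLeft]
  calc _ = 𝟙 _ ⊗≫ leftZigzag D.adj.unit D.adj.counit ⊗≫ 𝟙 _ := by bicategory
    _ = _ := by rw [D.adj.left_triangle]; bicategory

/-- Each half of the unit straightens a zigzag. -/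
lemma convLeft_convUnitSwap (D : DualPair a b) (p : D.X ⟶ D.X) :
    D.convLeft p D.convUnitSwap = p := by
  have h := D.cupLeft_comp_counit
  have h' := congrArg dag h
  rw [dag_comp, dag_whiskerLeft, dag_rightUnitor_inv] at h'
  rw [convLeft_eq, convUnitSwap_eq, Bicategory.whiskerLeft_comp, Category.assoc, h',
    ← whisker_exchange_assoc, reassoc_of% h]
  simp

lemma convLeft_convLeft (D : DualPair a b) (p : D.X ⟶ D.X) (u v : D.Y ≫ D.X ⟶ D.Y ≫ D.X) :
    D.convLeft (D.convLeft p u) v = D.convLeft p (D.convSwap u v) := by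
  have h := D.cupLeft_comp_cupLeft
  have h' : dag (D.cupLeft ≫ D.cupLeft ▷ (D.Y ≫ D.X) ≫ (α_ _ _ _).hom) =
    D.X ◁ dag D.cupMiddle ≫ dag D.cupLeft := by rw [h, dag_comp, dag_whiskerLeft]
  simp only [dag_comp, dag_whiskerRight, dag_associator, Category.assoc] at h'
  simp only [convLeft_eq, convSwap_eq, comp_whiskerRight, Bicategory.whiskerLeft_comp,
    Category.assoc]
  rw [← h', ← whisker_exchange_assoc (dag D.cupLeft) v, ← whisker_exchange_assoc p D.cupMiddle,
    ← reassoc_of% h]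
  simp

/-! ### Positivity of `z z*` for diagrams between different words. -/

/-- Whiskering a 2-endomorphism on the right, as a linear map. -/
@[simps]
def whiskerRightLin {f g : a ⟶ b} (h : b ⟶ c) : (f ⟶ g) →ₗ[ℂ] (f ≫ h ⟶ g ≫ h) where
  toFun x := x ▷ h
  map_add' x y := add_whiskerRight x y h
  map_smul' z x := smul_whiskerRight z x h

/-- Whiskering a 2-endomorphism on the left, as a linear map. -/
@[simps]
def whiskerLeftLin (h : a ⟶ b) {f g : b ⟶ c} : (f ⟶ g) →ₗ[ℂ] (h ≫ f ⟶ h ≫ g) where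
  toFun x := h ◁ x
  map_add' x y := whiskerLeft_add h x y
  map_smul' z x := whiskerLeft_smul h z x

/-- The trace as a linear functional. -/
def trLin (D : DualPair a b) (τ : D.Box 0 →ₗ[ℂ] ℂ) (n : ℕ) : D.Box n →ₗ[ℂ] ℂ :=
  τ ∘ₗ (Linear.leftComp ℂ (𝟙 a) (D.wordAdj n).unit ∘ₗ
    Linear.rightComp ℂ (D.word n ≫ D.dualWord n) (D.wordAdj' n).counit ∘ₗ whiskerRightLin _)

/-- The closure of a 2-endomorphism of two strings. -/
def clComp (D : DualPair a b) (E : DualPair b c) (x : D.X ≫ E.X ⟶ D.X ≫ E.X) : 𝟙 a ⟶ 𝟙 a :=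
  (D.comp E).cl x

lemma clComp_eq (D : DualPair a b) (E : DualPair b c) (x : D.X ≫ E.X ⟶ D.X ≫ E.X) :
    D.clComp E x = D.cl (E.partialCl x) := D.cl_comp E x

/-- A functional on 0-boxes as a function on 2-endomorphisms of the identity. -/
def evalZero (D : DualPair a b) (τ : D.Box 0 →ₗ[ℂ] ℂ) (x : 𝟙 a ⟶ 𝟙 a) : ℂ := τ x

variable {D : DualPair a b} {τ : D.Box 0 →ₗ[ℂ] ℂ}

lemma IsCStar.isFDCStar (h : D.IsCStar τ) (n : ℕ) : IsFDCStar (D.Box n) :=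
  ⟨h.finiteDimensional n, h.cstar n⟩

lemma IsCStar.isFaithfulTrace_one (h : D.IsCStar τ) : IsFaithfulTrace (D.trLin τ 1) where
  comm x y := congrArg τ (D.cl_comp_comm (x := y) (h.pivotal 1 y) x)
  pos := h.tr_pos 1

lemma IsCStar.isFaithfulTrace_two (h : D.IsCStar τ) : IsFaithfulTrace (D.trLin τ 2) where
  comm x y := congrArg τ ((D.comp D.swap).cl_comp_comm (x := y) (h.pivotal 2 y) x)
  pos := h.tr_pos 2

lemma IsCStar.trLin_nonneg (h : D.IsCStar τ) (n : ℕ) (x : D.Box n) :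
    0 ≤ D.trLin τ n (star x * x) := by
  by_cases h0 : x = 0
  · simp [h0]
  · exact (h.tr_pos n x h0).le

lemma IsCStar.eq_zero_of_trLin (h : D.IsCStar τ) {n : ℕ} {x : D.Box n}
    (hx : D.trLin τ n (star x * x) = 0) : x = 0 := by
  by_contra h0
  exact (h.tr_pos n x h0).ne' hx

/-- Positivity of `z z*` follows from that of its trace. -/
lemma isPos_comp_dag {f g : a ⟶ b} {φ : End f →ₗ[ℂ] ℂ} (hφ : IsFaithfulTrace φ)
    (hA : IsFDCStar (End f)) (h : ∀ z : f ⟶ g, 0 ≤ φ (z ≫ dag z)) (z : f ⟶ g) :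
    IsPos (A := End f) (z ≫ dag z) := by
  refine hφ.isPos_of_nonneg hA ?_ fun b => ?_
  · change dag (z ≫ dag z) = z ≫ dag z
    rw [dag_comp, dag_dag]
  -- Conjugation preserves the shape `z z*`, so nonnegative traces of all such diagrams suffice.
  · have h1 := h (dag b ≫ z)
    have e : (dag b ≫ z) ≫ dag (dag b ≫ z) = dag b ≫ (z ≫ dag z) ≫ b := by
      simp only [dag_comp, dag_dag, Category.assoc]
    rw [e] at h1
    exact h1

/-- Bending strings of `v` upwards turns the closure of `v v*` into that of another square, so its
trace can be read in a different box space. -/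
lemma cl_homEquiv₂ (D : DualPair a b) (E : DualPair b c) {g : a ⟶ c} (v : D.X ⟶ g ≫ E.Y) :
    D.cl (v ≫ dag v) =
      D.clComp E (E.adj.homEquiv₂.symm v ≫ dag (E.adj.homEquiv₂.symm v)) := by
  rw [clComp_eq, partialCl_comp_dag, Equiv.apply_symm_apply]

/-- Structural isomorphisms are unitary, so reassociating the target leaves `z z*` unchanged. -/
lemma comp_dag_of_iso {f g g' : a ⟶ b} (z : f ⟶ g) (θ : g ≅ g') (hθ : dag θ.hom = θ.inv) :
    (z ≫ θ.hom) ≫ dag (z ≫ θ.hom) = z ≫ dag z := by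
  rw [dag_comp, hθ]; simp

lemma IsCStar.evalZero_comp_dag_nonneg (h : D.IsCStar τ) (v : D.X ⟶ (D.X ≫ D.Y) ≫ D.X) :
    0 ≤ D.evalZero τ (D.cl (v ≫ dag v)) := by
  have e := D.cl_homEquiv₂ D.swap v
  exact (h.trLin_nonneg 2 _).trans_eq (congrArg (D.evalZero τ) e).symm

lemma IsCStar.eq_zero_of_evalZero_comp_dag (h : D.IsCStar τ) {v : D.X ⟶ (D.X ≫ D.Y) ≫ D.X}
    (hv : D.evalZero τ (D.cl (v ≫ dag v)) = 0) : v = 0 := by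
  have e := D.cl_homEquiv₂ D.swap v
  have h1 : D.adj'.homEquiv₂.symm v = (0 : D.X ≫ D.Y ⟶ D.X ≫ D.Y) :=
    h.eq_zero_of_trLin (n := 2) ((congrArg (D.evalZero τ) e).symm.trans hv)
  rw [Equiv.symm_apply_eq, Adjunction.homEquiv₂_apply] at h1
  have h2 : (0 : D.X ≫ D.Y ⟶ D.X ≫ D.Y) ▷ D.X = 0 := map_zero (whiskerRightLin D.X)
  rw [h1, h2]; simp

lemma IsCStar.evalZero_comp_dag_nonneg' (h : D.IsCStar τ) (v : D.X ⟶ D.X ≫ D.Y ≫ D.X) :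
    0 ≤ D.evalZero τ (D.cl (v ≫ dag v)) := by
  rw [← comp_dag_of_iso v (α_ D.X D.Y D.X).symm (dag_associator_inv _ _ _)]
  exact h.evalZero_comp_dag_nonneg _

lemma IsCStar.eq_zero_of_evalZero_comp_dag' (h : D.IsCStar τ) {v : D.X ⟶ D.X ≫ D.Y ≫ D.X}
    (hv : D.evalZero τ (D.cl (v ≫ dag v)) = 0) : v = 0 := by
  rw [← comp_dag_of_iso v (α_ D.X D.Y D.X).symm (dag_associator_inv _ _ _)] at hv
  have := h.eq_zero_of_evalZero_comp_dag hv
  exact (cancel_mono (α_ D.X D.Y D.X).symm.hom).1 (this.trans Limits.zero_comp.symm)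

lemma IsCStar.evalZero_two_comp_dag_nonneg (h : D.IsCStar τ)
    (w : D.X ≫ D.Y ⟶ (D.X ≫ D.Y) ≫ (D.X ≫ D.Y)) :
    0 ≤ D.evalZero τ (D.clComp D.swap (w ≫ dag w)) := by
  have e₁ : D.clComp D.swap (w ≫ dag w) = D.cl (D.adj'.homEquiv₂ w ≫ dag (D.adj'.homEquiv₂ w)) :=
    (D.clComp_eq D.swap _).trans (congrArg D.cl (D.swap.partialCl_comp_dag w))
  -- The six boundary strings of `w` are regrouped as three above and three below: one string has
  -- been bent down, and two will be bent up, giving a square of a 3-box.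
  let θ : ((D.X ≫ D.Y) ≫ D.X ≫ D.Y) ≫ D.X ≅ (D.X ≫ D.Y ≫ D.X) ≫ D.Y ≫ D.X :=
    whiskerRightIso (α_ (D.X ≫ D.Y) D.X D.Y).symm D.X ≪≫ α_ ((D.X ≫ D.Y) ≫ D.X) D.Y D.X ≪≫
      whiskerRightIso (α_ D.X D.Y D.X) (D.Y ≫ D.X)
  have hθ : dag θ.hom = θ.inv := by
    simp only [θ, Iso.trans_hom, Iso.trans_inv, whiskerRightIso_hom, whiskerRightIso_inv,
      Iso.symm_hom, Iso.symm_inv, dag_comp, dag_whiskerRight, dag_associator, dag_associator_inv]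
  have e₂ := D.cl_homEquiv₂ (D.swap.comp D) (D.adj'.homEquiv₂ w ≫ θ.hom)
  rw [e₁, ← comp_dag_of_iso _ θ hθ]
  exact (h.trLin_nonneg 3 _).trans_eq (congrArg (D.evalZero τ) e₂).symm

lemma IsCStar.evalZero_two_comp_dag_nonneg_of_cap (h : D.IsCStar τ) (w : D.X ≫ D.Y ⟶ 𝟙 a) :
    0 ≤ D.evalZero τ (D.clComp D.swap (w ≫ dag w)) := by
  have e₁ : D.clComp D.swap (w ≫ dag w) = D.cl (D.adj'.homEquiv₂ w ≫ dag (D.adj'.homEquiv₂ w)) :=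
    (D.clComp_eq D.swap _).trans (congrArg D.cl (D.swap.partialCl_comp_dag w))
  rw [e₁, ← comp_dag_of_iso (D.adj'.homEquiv₂ w) (λ_ D.X) (dag_leftUnitor _)]
  exact h.trLin_nonneg 1 _

lemma IsCStar.isPos_comp_dag_one (h : D.IsCStar τ) (v : D.X ⟶ (D.X ≫ D.Y) ≫ D.X) :
    IsPos (A := D.Box 1) (v ≫ dag v) :=
  isPos_comp_dag h.isFaithfulTrace_one (h.isFDCStar 1) h.evalZero_comp_dag_nonneg v

lemma IsCStar.isPos_comp_dag_one' (h : D.IsCStar τ) (v : D.X ⟶ D.X ≫ D.Y ≫ D.X) :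
    IsPos (A := D.Box 1) (v ≫ dag v) :=
  isPos_comp_dag h.isFaithfulTrace_one (h.isFDCStar 1) h.evalZero_comp_dag_nonneg' v

lemma IsCStar.isPos_comp_dag_two (h : D.IsCStar τ) (w : D.X ≫ D.Y ⟶ (D.X ≫ D.Y) ≫ (D.X ≫ D.Y)) :
    IsPos (A := D.Box 2) (w ≫ dag w) :=
  isPos_comp_dag h.isFaithfulTrace_two (h.isFDCStar 2) h.evalZero_two_comp_dag_nonneg w

lemma IsCStar.isPos_comp_dag_cap (h : D.IsCStar τ) (w : D.X ≫ D.Y ⟶ 𝟙 a) :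
    IsPos (A := D.Box 2) (w ≫ dag w) :=
  isPos_comp_dag h.isFaithfulTrace_two (h.isFDCStar 2) h.evalZero_two_comp_dag_nonneg_of_cap w

/-- This is the Schur product theorem in diagrams: a convolution of squares is a square. -/
lemma convLeft_comp_dag (D : DualPair a b) (y : D.X ⟶ D.X) (s : D.Y ≫ D.X ⟶ D.Y ≫ D.X) :
    D.convLeft (y ≫ dag y) (s ≫ dag s) = (D.cupLeft ≫ y ▷ (D.Y ≫ D.X) ≫ D.X ◁ s) ≫
      dag (D.cupLeft ≫ y ▷ (D.Y ≫ D.X) ≫ D.X ◁ s) := by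
  simp only [convLeft_eq, dag_comp, dag_whiskerLeft, dag_whiskerRight, comp_whiskerRight,
    Bicategory.whiskerLeft_comp, Category.assoc]
  rw [← whisker_exchange_assoc (dag y) s, whisker_exchange_assoc (dag y) (dag s)]

lemma convRightSwap_comp_dag (D : DualPair a b) (s : D.Y ≫ D.X ⟶ D.Y ≫ D.X) (y : D.Y ⟶ D.Y) :
    D.convRightSwap (s ≫ dag s) (y ≫ dag y) = (D.cupRight ≫ s ▷ D.Y ≫ (D.Y ≫ D.X) ◁ y) ≫
      dag (D.cupRight ≫ s ▷ D.Y ≫ (D.Y ≫ D.X) ◁ y) := by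
  simp only [convRightSwap_eq, dag_comp, dag_whiskerLeft, dag_whiskerRight, comp_whiskerRight,
    Bicategory.whiskerLeft_comp, Category.assoc]
  rw [← whisker_exchange_assoc (dag s) y, whisker_exchange_assoc (dag s) (dag y)]

lemma convSwap_comp_dag (D : DualPair a b) (s t : D.Y ≫ D.X ⟶ D.Y ≫ D.X) :
    D.convSwap (s ≫ dag s) (t ≫ dag t) =
      (D.cupMiddle ≫ s ▷ (D.Y ≫ D.X) ≫ (D.Y ≫ D.X) ◁ t) ≫
        dag (D.cupMiddle ≫ s ▷ (D.Y ≫ D.X) ≫ (D.Y ≫ D.X) ◁ t) := by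
  simp only [convSwap_eq, dag_comp, dag_whiskerLeft, dag_whiskerRight, comp_whiskerRight,
    Bicategory.whiskerLeft_comp, Category.assoc]
  rw [← whisker_exchange_assoc (dag s) t, whisker_exchange_assoc (dag s) (dag t)]

/-- Horizontal juxtaposition of 1-boxes of opposite shadings. -/
def tensorSwap (D : DualPair a b) (r : D.Y ⟶ D.Y) (q : D.X ⟶ D.X) : D.Y ≫ D.X ⟶ D.Y ≫ D.X :=
  r ▷ D.X ≫ D.Y ◁ q

/-- Sliding `p` around the cup rotates it to `p̄`, while `q` moves along the right string, so both
arrive at the 2-box as `p̄ ⊗ q`. -/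
lemma cupLeft_tensorSwap (D : DualPair a b) (p q : D.X ⟶ D.X) (s : D.Y ≫ D.X ⟶ D.Y ≫ D.X) :
    q ≫ D.cupLeft ≫ p ▷ (D.Y ≫ D.X) ≫ D.X ◁ s =
      D.cupLeft ≫ D.X ◁ (D.tensorSwap (D.rot p) q ≫ s) := by
  rw [tensorSwap, reassoc_of% D.cupLeft_comp_whiskerRight p, reassoc_of% D.comp_cupLeft q,
    ← whisker_exchange]
  simp only [Bicategory.whiskerLeft_comp, Category.assoc]

lemma cupRight_tensorSwap (D : DualPair a b) (r : D.Y ⟶ D.Y) (p : D.X ⟶ D.X)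
    (s : D.Y ≫ D.X ⟶ D.Y ≫ D.X) :
    r ≫ D.cupRight ≫ s ▷ D.Y ≫ (D.Y ≫ D.X) ◁ D.rot p =
      D.cupRight ≫ (D.tensorSwap r p ≫ s) ▷ D.Y := by
  rw [← whisker_exchange s (D.rot p), reassoc_of% D.cupRight_comp_whiskerLeft p,
    reassoc_of% D.comp_cupRight r, tensorSwap]
  simp only [comp_whiskerRight, Category.assoc]

/-- The convolution with a 2-box, as a linear map on 1-boxes. -/
def convLeftLin (D : DualPair a b) (u : D.Y ≫ D.X ⟶ D.Y ≫ D.X) :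
    (D.X ⟶ D.X) →ₗ[ℂ] (D.X ⟶ D.X) :=
  Linear.leftComp ℂ D.X D.cupLeft ∘ₗ
    Linear.rightComp ℂ (D.X ≫ D.Y ≫ D.X) (D.X ◁ u ≫ dag D.cupLeft) ∘ₗ whiskerRightLin (D.Y ≫ D.X)

lemma convLeftLin_apply (D : DualPair a b) (u : D.Y ≫ D.X ⟶ D.Y ≫ D.X) (p : D.X ⟶ D.X) :
    D.convLeftLin u p = D.convLeft p u := by
  rw [convLeft_eq]; rfl

/-- The convolution with a 1-box, as a linear map on 2-boxes. -/
def convLeftLinRight (D : DualPair a b) (p : D.X ⟶ D.X) :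
    (D.Y ≫ D.X ⟶ D.Y ≫ D.X) →ₗ[ℂ] (D.X ⟶ D.X) :=
  Linear.leftComp ℂ D.X (D.cupLeft ≫ p ▷ (D.Y ≫ D.X)) ∘ₗ
    Linear.rightComp ℂ (D.X ≫ D.Y ≫ D.X) (dag D.cupLeft) ∘ₗ whiskerLeftLin D.X

lemma convLeftLinRight_apply (D : DualPair a b) (u : D.Y ≫ D.X ⟶ D.Y ≫ D.X) (p : D.X ⟶ D.X) :
    D.convLeftLinRight p u = D.convLeft p u := by
  rw [convLeft_eq, ← Category.assoc]; rfl

/-- Convolving with the identity 2-box frees the closed-up `p` to the left of a through string. -/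
lemma convLeft_id (D : DualPair a b) (p : D.X ⟶ D.X) :
    D.convLeft p (𝟙 _) = (λ_ _).inv ≫ D.cl p ▷ D.X ≫ (λ_ _).hom := by
  rw [convLeft_eq, dag_cupLeft, cupLeft, cl]
  bicategory

lemma cl_comp_convLeft_id (D : DualPair a b) (p q : D.X ⟶ D.X) :
    D.cl (q ≫ D.convLeft p (𝟙 _)) = D.cl q ≫ D.cl p := by
  rw [convLeft_id]
  simp only [cl]
  calc _ = D.adj.unit ≫ q ▷ D.Y ⊗≫ ((D.adj.unit ≫ p ▷ D.Y ≫ D.adj'.counit) ▷ (D.X ≫ D.Y) ≫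
        𝟙 _ ◁ D.adj'.counit) ⊗≫ 𝟙 _ := by bicategory
    _ = _ := by rw [← whisker_exchange]; bicategory

/-! ### Positivity of convolution and the trace criterion for `u (p̄ ⊗ q) = 0`. -/

variable {τ' : D.swap.Box 0 →ₗ[ℂ] ℂ}

lemma IsCStar.isPos_convLeft (h : D.IsCStar τ) {p : D.X ⟶ D.X} {u : D.Y ≫ D.X ⟶ D.Y ≫ D.X}
    (hp : IsPos (A := D.Box 1) p) (hu : IsPos (A := D.swap.Box 2) u) :
    IsPos (A := D.Box 1) (D.convLeft p u) := by
  obtain ⟨y, hy⟩ := hp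
  obtain ⟨s, hs⟩ := hu
  change D.X ⟶ D.X at y
  change D.Y ≫ D.X ⟶ D.Y ≫ D.X at s
  have e := D.convLeft_comp_dag (dag y) (dag s)
  rw [dag_dag, dag_dag] at e
  have := h.isPos_comp_dag_one' (D.cupLeft ≫ dag y ▷ (D.Y ≫ D.X) ≫ D.X ◁ dag s)
  rw [hy, hs]
  exact e.symm ▸ this

lemma IsCStar.isPos_convRightSwap (h : D.swap.IsCStar τ') {q : D.Y ⟶ D.Y}
    {u : D.Y ≫ D.X ⟶ D.Y ≫ D.X} (hq : IsPos (A := D.swap.Box 1) q)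
    (hu : IsPos (A := D.swap.Box 2) u) : IsPos (A := D.swap.Box 1) (D.convRightSwap u q) := by
  obtain ⟨y, hy⟩ := hq
  obtain ⟨s, hs⟩ := hu
  change D.Y ⟶ D.Y at y
  change D.Y ≫ D.X ⟶ D.Y ≫ D.X at s
  have e := D.convRightSwap_comp_dag (dag s) (dag y)
  rw [dag_dag, dag_dag] at e
  have := h.isPos_comp_dag_one (D.cupRight ≫ dag s ▷ D.Y ≫ (D.Y ≫ D.X) ◁ dag y)
  rw [hy, hs]
  exact e.symm ▸ this

lemma IsCStar.isPos_convSwap (h : D.swap.IsCStar τ') {u v : D.Y ≫ D.X ⟶ D.Y ≫ D.X}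
    (hu : IsPos (A := D.swap.Box 2) u) (hv : IsPos (A := D.swap.Box 2) v) :
    IsPos (A := D.swap.Box 2) (D.convSwap u v) := by
  obtain ⟨s, hs⟩ := hu
  obtain ⟨t, ht⟩ := hv
  change D.Y ≫ D.X ⟶ D.Y ≫ D.X at s
  change D.Y ≫ D.X ⟶ D.Y ≫ D.X at t
  have e := D.convSwap_comp_dag (dag s) (dag t)
  rw [dag_dag, dag_dag] at e
  have := h.isPos_comp_dag_two
    (D.cupMiddle ≫ dag s ▷ (D.Y ≫ D.X) ≫ (D.Y ≫ D.X) ◁ dag t)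
  rw [hs, ht]
  exact e.symm ▸ this

lemma IsCStar.isPos_convUnitSwap (h : D.swap.IsCStar τ') :
    IsPos (A := D.swap.Box 2) D.convUnitSwap := by
  rw [convUnitSwap_eq]
  exact h.isPos_comp_dag_cap D.adj.counit

lemma IsCStar.comp_eq_zero_iff (h : D.swap.IsCStar τ') (t s : D.Y ≫ D.X ⟶ D.Y ≫ D.X) :
    t ≫ s ≫ dag s = 0 ↔ t ≫ s = 0 := by
  constructor
  · intro h0
    refine (h.isFDCStar 2).star_mul_self_eq_zero (x := (t ≫ s : D.Y ≫ D.X ⟶ D.Y ≫ D.X)) ?_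
    change (t ≫ s) ≫ dag (t ≫ s) = 0
    rw [dag_comp, Category.assoc, ← Category.assoc s, ← Category.assoc t, h0, Limits.zero_comp]
  · intro h0
    rw [← Category.assoc, h0, Limits.zero_comp]

/-- Writing `u` as a square makes the trace that of `v v*`. Faithfulness reduces its vanishing to `v
= 0`; removing the cup and passing from the square root back to `u` leaves the 2-box equation. -/
lemma IsCStar.trLin_convLeft_eq_zero_iff (h : D.IsCStar τ) (h' : D.swap.IsCStar τ')
    {p q : D.X ⟶ D.X} {u : D.Y ≫ D.X ⟶ D.Y ≫ D.X}
    (hp : IsStarProjection (R := D.Box 1) p) (hq : IsStarProjection (R := D.Box 1) q)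
    (hu : IsPos (A := D.swap.Box 2) u) :
    D.evalZero τ (D.cl (q ≫ D.convLeft p u)) = 0 ↔
      D.tensorSwap (D.rot p) q ≫ u = 0 := by
  obtain ⟨s, hs⟩ := hu
  change D.Y ≫ D.X ⟶ D.Y ≫ D.X at s
  have hs : u = dag s ≫ s := hs
  have hpd : dag p = p := hp.isSelfAdjoint
  have hpp : p ≫ p = p := hp.isIdempotentElem
  have hqd : dag q = q := hq.isSelfAdjoint
  set v := q ≫ D.cupLeft ≫ p ▷ (D.Y ≫ D.X) ≫ D.X ◁ dag s with hv
  have e₁ : D.evalZero τ (D.cl (q ≫ D.convLeft p u)) =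
      D.evalZero τ (D.cl (v ≫ dag v)) := by
    have e₂ := D.convLeft_comp_dag p (dag s)
    rw [hpd, hpp, dag_dag, ← hs] at e₂
    have e₃ : v ≫ dag v = q ≫ D.convLeft p u ≫ q := by
      rw [hv, dag_comp, hqd, e₂]; simp only [Category.assoc]
    rw [e₃]
    exact h.isFaithfulTrace_one.map_conj (D.convLeft p u) hq.isIdempotentElem.eq
  rw [e₁, hs]
  have e₆ := h'.comp_eq_zero_iff (D.tensorSwap (D.rot p) q) (dag s)
  rw [dag_dag] at e₆
  rw [e₆, hv, cupLeft_tensorSwap]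
  have e₇ : D.cupLeft ≫ D.X ◁ (0 : D.Y ≫ D.X ⟶ D.Y ≫ D.X) = 0 := by
    rw [show D.X ◁ (0 : D.Y ≫ D.X ⟶ D.Y ≫ D.X) = 0 from map_zero (whiskerLeftLin D.X),
      Limits.comp_zero]
  constructor
  · intro h0
    exact D.cupLeft_comp_injective ((h.eq_zero_of_evalZero_comp_dag' h0).trans e₇.symm)
  · intro h0
    rw [h0, e₇, Limits.zero_comp]
    exact map_zero (D.trLin τ 1)

lemma IsCStar.trLin_convRightSwap_eq_zero_iff (h' : D.swap.IsCStar τ')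
    {r : D.Y ⟶ D.Y} {p : D.X ⟶ D.X} {u : D.Y ≫ D.X ⟶ D.Y ≫ D.X}
    (hp : IsStarProjection (R := D.swap.Box 1) (D.rot p))
    (hr : IsStarProjection (R := D.swap.Box 1) r)
    (hu : IsPos (A := D.swap.Box 2) u) :
    D.swap.evalZero τ' (D.swap.cl (r ≫ D.convRightSwap u (D.rot p))) = 0 ↔
      D.tensorSwap r p ≫ u = 0 := by
  obtain ⟨s, hs⟩ := hu
  change D.Y ≫ D.X ⟶ D.Y ≫ D.X at s
  have hs : u = dag s ≫ s := hs
  have hpd : dag (D.rot p) = D.rot p := hp.isSelfAdjoint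
  have hpp : D.rot p ≫ D.rot p = D.rot p := hp.isIdempotentElem
  have hrd : dag r = r := hr.isSelfAdjoint
  set v := r ≫ D.cupRight ≫ dag s ▷ D.Y ≫ (D.Y ≫ D.X) ◁ D.rot p with hv
  have e₁ : D.swap.evalZero τ' (D.swap.cl (r ≫ D.convRightSwap u (D.rot p))) =
      D.swap.evalZero τ' (D.swap.cl (v ≫ dag v)) := by
    have e₂ := D.convRightSwap_comp_dag (dag s) (D.rot p)
    rw [hpd, hpp, dag_dag, ← hs] at e₂
    have e₃ : v ≫ dag v = r ≫ D.convRightSwap u (D.rot p) ≫ r := by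
      rw [hv, dag_comp, hrd, e₂]; simp only [Category.assoc]
    refine Eq.trans ?_ (congrArg (fun x => D.swap.evalZero τ' (D.swap.cl x)) e₃).symm
    exact h'.isFaithfulTrace_one.map_conj (D.convRightSwap u (D.rot p)) hr.isIdempotentElem.eq
  rw [e₁, hs]
  have e₆ := h'.comp_eq_zero_iff (D.tensorSwap r p) (dag s)
  rw [dag_dag] at e₆
  rw [e₆, hv, cupRight_tensorSwap]
  have e₇ : D.cupRight ≫ (0 : D.Y ≫ D.X ⟶ D.Y ≫ D.X) ▷ D.Y = 0 := by
    rw [show (0 : D.Y ≫ D.X ⟶ D.Y ≫ D.X) ▷ D.Y = 0 from map_zero (whiskerRightLin D.Y),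
      Limits.comp_zero]
  constructor
  · intro h0
    exact D.cupRight_comp_injective ((h'.eq_zero_of_evalZero_comp_dag h0).trans e₇.symm)
  · intro h0
    have e₈ : (D.cupRight ≫ (D.tensorSwap r p ≫ dag s) ▷ D.Y) ≫
        dag (D.cupRight ≫ (D.tensorSwap r p ≫ dag s) ▷ D.Y) = 0 := by
      rw [h0, e₇, Limits.zero_comp]
    exact (congrArg (fun x => D.swap.evalZero τ' (D.swap.cl x)) e₈).trans
      (map_zero (D.swap.trLin τ' 1))

lemma rot_comp (D : DualPair a b) (p q : D.X ⟶ D.X) : D.rot (p ≫ q) = D.rot q ≫ D.rot p := by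
  simp only [rot_eq]
  exact (conjugateEquiv_comp D.adj D.adj D.adj q p).symm

lemma rot_id (D : DualPair a b) : D.rot (𝟙 D.X) = 𝟙 D.Y := by
  rw [rot_eq]; exact conjugateEquiv_id D.adj

lemma rot_surjective (D : DualPair a b) : Function.Surjective D.rot := fun q =>
  ⟨(conjugateEquiv D.adj D.adj).symm q, by rw [rot_eq, Equiv.apply_symm_apply]⟩

lemma rot_injective (D : DualPair a b) : Function.Injective D.rot := fun p q h =>
  (conjugateEquiv D.adj D.adj).injective (by rwa [← rot_eq, ← rot_eq])

lemma rot_sub (D : DualPair a b) (p q : D.X ⟶ D.X) : D.rot (p - q) = D.rot p - D.rot q := by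
  have h : ∀ p, D.rot p = (((ρ_ _).inv ≫ D.Y ◁ D.adj.unit) ≫ whiskerLeftLin D.Y
      (whiskerRightLin D.Y p)) ≫ (α_ _ _ _).inv ≫ D.adj.counit ▷ D.Y ≫ (λ_ _).hom := fun p => by
    rw [rot_eq, conjugateEquiv_apply']; simp
  simp only [h, map_sub, Preadditive.comp_sub, Preadditive.sub_comp]

lemma dag_tensorSwap (D : DualPair a b) (r : D.Y ⟶ D.Y) (q : D.X ⟶ D.X) :
    dag (D.tensorSwap r q) = D.tensorSwap (dag r) (dag q) := by
  rw [tensorSwap, dag_comp, dag_whiskerLeft, dag_whiskerRight, whisker_exchange, tensorSwap]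

lemma tensorSwap_comp (D : DualPair a b) (r r' : D.Y ⟶ D.Y) (q q' : D.X ⟶ D.X) :
    D.tensorSwap r q ≫ D.tensorSwap r' q' = D.tensorSwap (r ≫ r') (q ≫ q') := by
  simp only [tensorSwap, comp_whiskerRight, Bicategory.whiskerLeft_comp, Category.assoc]
  rw [whisker_exchange_assoc]

/-- Reflection exchanges the two directions of rotation, which pivotality identifies. -/
lemma IsCStar.dag_rot (h : D.IsCStar τ) (p : D.X ⟶ D.X) : dag (D.rot p) = D.rot (dag p) := by
  have hp : conjugateEquiv D.adj D.adj (dag p) = (conjugateEquiv D.adj' D.adj').symm (dag p) :=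
    h.pivotal 1 (dag p)
  rw [rot_eq, rot_eq, hp, conjugateEquiv_symm_apply', conjugateEquiv_apply']
  simp only [dag_comp, dag_whiskerLeft, dag_whiskerRight, dag_associator_inv, dag_rightUnitor_inv,
    dag_leftUnitor, D.dag_unit, D.dag_counit, Category.assoc]

lemma IsCStar.isStarProjection_rot_iff (h : D.IsCStar τ) {p : D.X ⟶ D.X} :
    IsStarProjection (R := D.swap.Box 1) (D.rot p) ↔ IsStarProjection (R := D.Box 1) p := by
  constructor
  · rintro ⟨h1, h2⟩
    have h1 : D.rot p ≫ D.rot p = D.rot p := h1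
    have h2 : dag (D.rot p) = D.rot p := h2
    rw [← rot_comp] at h1
    rw [h.dag_rot] at h2
    exact ⟨D.rot_injective h1, D.rot_injective h2⟩
  · rintro ⟨h1, h2⟩
    have h1 : p ≫ p = p := h1
    have h2 : dag p = p := h2
    have h3 : D.rot p ≫ D.rot p = D.rot p := by rw [← rot_comp, h1]
    have h4 : dag (D.rot p) = D.rot p := by rw [h.dag_rot, h2]
    exact ⟨h3, h4⟩

lemma IsCStar.isStarProjection_tensorSwap (h : D.IsCStar τ) {p q : D.X ⟶ D.X}
    (hp : IsStarProjection (R := D.Box 1) p) (hq : IsStarProjection (R := D.Box 1) q) :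
    IsStarProjection (R := D.swap.Box 2) (D.tensorSwap (D.rot p) q) := by
  have h1 : D.rot p ≫ D.rot p = D.rot p := (h.isStarProjection_rot_iff.2 hp).isIdempotentElem
  have h2 : dag (D.rot p) = D.rot p := (h.isStarProjection_rot_iff.2 hp).isSelfAdjoint
  have h3 : q ≫ q = q := hq.isIdempotentElem
  have h4 : dag q = q := hq.isSelfAdjoint
  have h5 : D.tensorSwap (D.rot p) q ≫ D.tensorSwap (D.rot p) q = D.tensorSwap (D.rot p) q := by
    rw [tensorSwap_comp, h1, h3]
  have h6 : dag (D.tensorSwap (D.rot p) q) = D.tensorSwap (D.rot p) q := by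
    rw [dag_tensorSwap, h2, h4]
  exact ⟨h5, h6⟩

end DualPair

/-! ### The statements of the theorem as irreducibility of the convolution map. -/

namespace CStarPlanarAlgebra

variable {B : Type u} [Bicategory.{w, v} B]
    [∀ a b : B, Preadditive (a ⟶ b)] [∀ a b : B, Linear ℂ (a ⟶ b)] [StarBicategory B]
    (𝔓 : CStarPlanarAlgebra B)

lemma isFDCStar_P (n : ℕ) : IsFDCStar (𝔓.P n) := 𝔓.isCStar_plus.isFDCStar n

lemma isFDCStar_N (n : ℕ) : IsFDCStar (𝔓.N n) := 𝔓.isCStar_minus.isFDCStar n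

/-- The trace on `P_{1,+}`. -/
noncomputable def τ₁ : 𝔓.P 1 →ₗ[ℂ] ℂ := 𝔓.gen.trLin 𝔓.trPlus 1

lemma isFaithfulTrace_τ₁ : IsFaithfulTrace 𝔓.τ₁ := 𝔓.isCStar_plus.isFaithfulTrace_one

/-- The convolution `p * u` as a linear function of `p`. -/
noncomputable def convMap (u : 𝔓.N 2) : 𝔓.P 1 →ₗ[ℂ] 𝔓.P 1 := 𝔓.gen.convLeftLin u

/-- The convolution `p * u` as a linear function of `u`. -/
noncomputable def convMapRight (p : 𝔓.P 1) : 𝔓.N 2 →ₗ[ℂ] 𝔓.P 1 := 𝔓.gen.convLeftLinRight p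

lemma convMap_apply (u : 𝔓.N 2) (p : 𝔓.P 1) : 𝔓.convMap u p = 𝔓.conv12 p u :=
  𝔓.gen.convLeftLin_apply u p

lemma convMapRight_apply (u : 𝔓.N 2) (p : 𝔓.P 1) : 𝔓.convMapRight p u = 𝔓.conv12 p u :=
  𝔓.gen.convLeftLinRight_apply u p

lemma convMap_add (u v : 𝔓.N 2) : 𝔓.convMap (u + v) = 𝔓.convMap u + 𝔓.convMap v := by
  ext p
  simp only [LinearMap.add_apply, convMap_apply, ← convMapRight_apply, map_add]

lemma convMap_unit : 𝔓.convMap 𝔓.unit = 1 := by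
  ext p
  rw [convMap_apply]
  exact 𝔓.gen.convLeft_convUnitSwap p

/-- Convolution powers become powers of a single operator, to which Perron–Frobenius theory applies.
-/
lemma conv12_pow (u : 𝔓.N 2) (k : ℕ) (p : 𝔓.P 1) :
    𝔓.conv12 p (𝔓.pow u k) = (𝔓.convMap u ^ k) p := by
  induction k with
  | zero => exact 𝔓.gen.convLeft_convUnitSwap p
  | succ k ih =>
    rw [pow_succ', Module.End.mul_apply, ← ih, convMap_apply]
    exact (𝔓.gen.convLeft_convLeft p (𝔓.pow u k) u).symm

variable {𝔓}

lemma isPos_convMap {u : 𝔓.N 2} (hu : IsPos u) (p : 𝔓.P 1) (hp : IsPos p) :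
    IsPos (𝔓.convMap u p) := by
  rw [convMap_apply]
  exact 𝔓.isCStar_plus.isPos_convLeft hp hu

lemma isPos_convMapRight {p : 𝔓.P 1} (hp : IsPos p) (u : 𝔓.N 2) (hu : IsPos u) :
    IsPos (𝔓.convMapRight p u) := by
  rw [convMapRight_apply]
  exact 𝔓.isCStar_plus.isPos_convLeft hp hu

lemma isPos_unit : IsPos 𝔓.unit := 𝔓.isCStar_minus.isPos_convUnitSwap

lemma isPos_pow {u : 𝔓.N 2} (hu : IsPos u) (k : ℕ) : IsPos (𝔓.pow u k) := by
  induction k with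
  | zero => exact isPos_unit
  | succ k ih => exact 𝔓.isCStar_minus.isPos_convSwap ih hu

lemma dominated_convMap {u v : 𝔓.N 2} (h : Dominated u v) {p : 𝔓.P 1} (hp : IsPos p) :
    Dominated (𝔓.convMap u p) (𝔓.convMap v p) := by
  have := IsFDCStar.dominated_map (isPos_convMapRight hp) h
  rwa [convMapRight_apply, convMapRight_apply, ← convMap_apply, ← convMap_apply] at this

lemma convSupport_spec {x : 𝔓.P 2} (hx : 𝔓.IsFPositive x) :
    IsStarProjection (𝔓.convSupport x) ∧
      (∀ k, Dominated (𝔓.pow (𝔓.hat x) k) (𝔓.convSupport x)) ∧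
      ∃ N, Dominated (𝔓.convSupport x) (∑ k ∈ Finset.range N, 𝔓.pow (𝔓.hat x) k) :=
  (𝔓.isFDCStar_N 2).projJoin_spec fun k => isPos_pow hx k

lemma dominated_one_convSupport_iff {x : 𝔓.P 2} (hx : 𝔓.IsFPositive x) :
    (∀ p : 𝔓.P 1, IsStarProjection p → p ≠ 0 → Dominated 1 (𝔓.convMap (𝔓.convSupport x) p)) ↔
      IsIrreducibleMap (𝔓.convMap (𝔓.hat x)) := by
  obtain ⟨h1, h2, N, h3⟩ := convSupport_spec hx
  refine (𝔓.isFDCStar_P 1).dominated_one_iff_isIrreducibleMap (isPos_convMap hx)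
    (isPos_convMap h1.isPos) (fun k p hp => ?_) ⟨N, fun p hp => ?_⟩
  · rw [← conv12_pow, ← convMap_apply]
    exact dominated_convMap (h2 k) hp
  · have := IsFDCStar.dominated_map (isPos_convMapRight hp) h3
    rw [map_sum, convMapRight_apply, ← convMap_apply] at this
    simpa only [convMapRight_apply, conv12_pow] using this

lemma isIrreducible_iff (x : 𝔓.P 2) :
    𝔓.IsIrreducible x ↔ IsIrreducibleMap (𝔓.convMap (𝔓.hat x)) := by
  simp only [IsIrreducible, IsIrreducibleMap, Dominated, convMap_apply]
  exact ⟨fun h p hp ⟨c, hc, hcp⟩ => h p hp c hc hcp, fun h p hp c hc hcp => h p hp ⟨c, hc, hcp⟩⟩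

lemma rangeProj_conv12_iff {u : 𝔓.N 2} (hu : IsPos u) :
    (∀ p : 𝔓.P 1, IsStarProjection p → p ≠ 0 → rangeProj (𝔓.conv12 p u) = 1) ↔
      ∀ p : 𝔓.P 1, IsStarProjection p → p ≠ 0 → Dominated 1 (𝔓.convMap u p) := by
  refine forall_congr' fun p => forall_congr' fun hp => forall_congr' fun _ => ?_
  rw [← convMap_apply]
  exact (𝔓.isFDCStar_P 1).rangeProj_eq_one_iff (isPos_convMap hu p hp.isPos)

lemma isStrictlyPos_conv12_pow_iff {u : 𝔓.N 2} (hu : IsPos u) (n : ℕ) :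
    (∀ p : 𝔓.P 1, IsStarProjection p → p ≠ 0 → IsStrictlyPos (𝔓.conv12 p (𝔓.pow u n))) ↔
      ∀ p : 𝔓.P 1, IsStarProjection p → p ≠ 0 → Dominated 1 ((𝔓.convMap u ^ n) p) := by
  refine forall_congr' fun p => forall_congr' fun hp => forall_congr' fun _ => ?_
  rw [conv12_pow]
  exact (𝔓.isFDCStar_P 1).isStrictlyPos_iff (IsFDCStar.isPos_pow (isPos_convMap hu) n hp.isPos)

lemma trace_convMap_eq_zero_iff {u : 𝔓.N 2} (hu : IsPos u) {p q : 𝔓.P 1}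
    (hp : IsStarProjection p) (hq : IsStarProjection q) :
    𝔓.τ₁ (𝔓.convMap u p * q) = 0 ↔ u * 𝔓.barTensor p q = 0 := by
  rw [convMap_apply]
  exact 𝔓.isCStar_plus.trLin_convLeft_eq_zero_iff 𝔓.isCStar_minus hp hq hu

lemma isStarProjection_barTensor {p q : 𝔓.P 1} (hp : IsStarProjection p)
    (hq : IsStarProjection q) : IsStarProjection (𝔓.barTensor p q) :=
  𝔓.isCStar_plus.isStarProjection_tensorSwap hp hq

variable (𝔓) in
/-- The rotation of 1-boxes by 180 degrees. -/
def bar (p : 𝔓.P 1) : 𝔓.N 1 := 𝔓.gen.rot p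

lemma isStarProjection_bar_iff {p : 𝔓.P 1} : IsStarProjection (𝔓.bar p) ↔ IsStarProjection p :=
  𝔓.isCStar_plus.isStarProjection_rot_iff

lemma bar_surjective : Function.Surjective 𝔓.bar := 𝔓.gen.rot_surjective

lemma bar_one_sub (p : 𝔓.P 1) : 𝔓.bar (1 - p) = 1 - 𝔓.bar p := by
  have h := 𝔓.gen.rot_sub (𝟙 _) p
  rw [𝔓.gen.rot_id] at h
  exact h

lemma bar_eq_one_iff {p : 𝔓.P 1} : 𝔓.bar p = 1 ↔ p = 1 := by
  have h : 𝔓.bar 1 = 1 := 𝔓.gen.rot_id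
  exact ⟨fun hp => 𝔓.gen.rot_injective (hp.trans h.symm), fun hp => hp ▸ h⟩

lemma bar_eq_zero_iff {p : 𝔓.P 1} : 𝔓.bar p = 0 ↔ p = 0 := by
  have h : 𝔓.bar 0 = 0 := by
    have h1 := bar_one_sub (1 : 𝔓.P 1)
    rwa [bar_eq_one_iff.2 rfl, sub_self, sub_self] at h1
  exact ⟨fun hp => 𝔓.gen.rot_injective (hp.trans h.symm), fun hp => hp ▸ h⟩

/-- Convolution on the left and on the right have complementary invariant projections. -/
lemma dominated_conv21_iff {u : 𝔓.N 2} (hu : IsPos u) {p : 𝔓.P 1} (hp : IsStarProjection p) :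
    Dominated (𝔓.conv21 u (𝔓.bar (1 - p))) (𝔓.bar (1 - p)) ↔ Dominated (𝔓.convMap u p) p := by
  have hr := isStarProjection_bar_iff.2 hp.one_sub
  have hpos : IsPos (𝔓.conv21 u (𝔓.bar (1 - p))) :=
    𝔓.isCStar_minus.isPos_convRightSwap hr.isPos hu
  rw [𝔓.isFaithfulTrace_τ₁.dominated_iff (𝔓.isFDCStar_P 1) (isPos_convMap hu p hp.isPos) hp,
    trace_convMap_eq_zero_iff hu hp hp.one_sub,
    𝔓.isCStar_minus.isFaithfulTrace_one.dominated_iff (𝔓.isFDCStar_N 1) hpos hr, ← bar_one_sub, sub_sub_cancel]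
  -- Both domination conditions amount to `u (p̄ ⊗ (1 - p)) = 0`.
  exact 𝔓.isCStar_minus.trLin_convRightSwap_eq_zero_iff hr (isStarProjection_bar_iff.2 hp) hu

lemma isIrreducibleMap_iff_conv21 {u : 𝔓.N 2} (hu : IsPos u) :
    IsIrreducibleMap (𝔓.convMap u) ↔ ∀ q : 𝔓.N 1, IsStarProjection q →
      ∀ c : ℝ, 0 < c → PosLE (𝔓.conv21 u q) ((c : ℂ) • q) → q = 0 ∨ q = 1 := by
  constructor
  · intro h q hq c hc hqc
    obtain ⟨p, rfl⟩ := bar_surjective q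
    rw [isStarProjection_bar_iff] at hq
    have h1 := (dominated_conv21_iff hu hq.one_sub).1
      (by rw [sub_sub_cancel]; exact ⟨c, hc, hqc⟩)
    rw [bar_eq_zero_iff, bar_eq_one_iff]
    rcases h _ hq.one_sub h1 with h2 | h2
    · exact Or.inr (sub_eq_zero.1 h2).symm
    · exact Or.inl (by simpa using h2)
  · intro h p hp hpT
    obtain ⟨c, hc, hqc⟩ := (dominated_conv21_iff hu hp).2 hpT
    rcases h _ (isStarProjection_bar_iff.2 hp.one_sub) c hc hqc with h2 | h2
    · rw [bar_eq_zero_iff] at h2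
      exact Or.inr (sub_eq_zero.1 h2).symm
    · rw [bar_eq_one_iff] at h2
      exact Or.inl (by simpa using h2)

lemma isPos_e₁ : IsPos 𝔓.e₁ := ((𝔓.isFDCStar_N 2).rangeProj_spec isPos_unit).1.isPos

lemma dominated_unit_e₁ : Dominated 𝔓.unit 𝔓.e₁ :=
  ((𝔓.isFDCStar_N 2).rangeProj_spec isPos_unit).2.2.2.2

lemma dominated_e₁_unit : Dominated 𝔓.e₁ 𝔓.unit :=
  ((𝔓.isFDCStar_N 2).rangeProj_spec isPos_unit).2.2.2.1

/-- Convolution by `unit + u` is the operator `1 + T`. -/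
lemma isIrreducibleMap_iff_unit {u : 𝔓.N 2} (hu : IsPos u) :
    IsIrreducibleMap (𝔓.convMap u) ↔ ∀ p : 𝔓.P 1, IsStarProjection p → p ≠ 0 →
      IsStrictlyPos (𝔓.conv12 p (𝔓.pow (𝔓.unit + u) (Module.finrank ℂ (𝔓.P 1) - 1))) := by
  rw [isStrictlyPos_conv12_pow_iff ((𝔓.isFDCStar_N 2).add isPos_unit hu), convMap_add, convMap_unit]
  exact ⟨fun h p hp hp0 => (𝔓.isFDCStar_P 1).dominated_one_pow (isPos_convMap hu) h hp hp0,
    (𝔓.isFDCStar_P 1).isIrreducibleMap_of_pow (isPos_convMap hu)⟩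

/-- The Jones projection and the unit dominate each other, so convolution by `e₁` is equivalent to
the identity map up to constants. -/
lemma isStrictlyPos_e₁_iff_unit {u : 𝔓.N 2} (hu : IsPos u) (n : ℕ) :
    (∀ p : 𝔓.P 1, IsStarProjection p → p ≠ 0 →
      IsStrictlyPos (𝔓.conv12 p (𝔓.pow (𝔓.e₁ + u) n))) ↔
    ∀ p : 𝔓.P 1, IsStarProjection p → p ≠ 0 →
      IsStrictlyPos (𝔓.conv12 p (𝔓.pow (𝔓.unit + u) n)) := by
  rw [isStrictlyPos_conv12_pow_iff ((𝔓.isFDCStar_N 2).add isPos_e₁ hu),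
    isStrictlyPos_conv12_pow_iff ((𝔓.isFDCStar_N 2).add isPos_unit hu),
    convMap_add, convMap_add, convMap_unit]
  refine forall_congr' fun p => forall_congr' fun hp => forall_congr' fun _ => ?_
  refine (𝔓.isFDCStar_P 1).dominated_one_pow_iff (isPos_convMap hu) (isPos_convMap isPos_e₁)
    (fun a ha => ?_) (fun a ha => ?_) n hp.isPos
  · simpa [convMap_unit] using dominated_convMap dominated_e₁_unit ha
  · simpa [convMap_unit] using dominated_convMap dominated_unit_e₁ ha

lemma isIrreducibleMap_iff_inner {u : 𝔓.N 2} (hu : IsPos u) :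
    IsIrreducibleMap (𝔓.convMap u) ↔ ∀ y₁ y₂ : 𝔓.P 1, IsPos y₁ → IsPos y₂ → y₁ ≠ 0 → y₂ ≠ 0 →
      𝔓.inner y₁ y₂ = 0 → ∃ k : ℕ, k < Module.finrank ℂ (𝔓.P 1) ∧
        0 < 𝔓.inner (𝔓.conv12 y₁ (𝔓.pow u k)) y₂ := by
  simp only [conv12_pow]
  exact ⟨fun h y₁ y₂ h₁ h₂ hne₁ hne₂ _ => 𝔓.isFaithfulTrace_τ₁.exists_pow_of_isIrreducibleMap
    (𝔓.isFDCStar_P 1) (isPos_convMap hu) h h₁ h₂ hne₁ hne₂,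
    𝔓.isFaithfulTrace_τ₁.isIrreducibleMap_of_exists_pow (𝔓.isFDCStar_P 1) (isPos_convMap hu)⟩

lemma mul_barTensor_ne_zero_iff {x : 𝔓.P 2} (hx : 𝔓.IsFPositive x) :
    (∀ p₁ p₂ : 𝔓.P 1, IsMinProj p₁ → IsMinProj p₂ →
      𝔓.convSupport x * 𝔓.barTensor p₁ p₂ ≠ 0) ↔
      ∀ p : 𝔓.P 1, IsStarProjection p → p ≠ 0 → Dominated 1 (𝔓.convMap (𝔓.convSupport x) p) := by
  have hB := (convSupport_spec hx).1.isPos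
  rw [𝔓.isFaithfulTrace_τ₁.dominated_one_iff_isMinProj (𝔓.isFDCStar_P 1) (isPos_convMap hB)]
  refine forall_congr' fun p₁ => forall_congr' fun p₂ => forall_congr' fun h₁ =>
    forall_congr' fun h₂ => ?_
  rw [ne_eq, ne_eq, trace_convMap_eq_zero_iff hB h₁.1 h₂.1]

lemma tr_mul_barTensor_ne_zero_iff {u : 𝔓.N 2} (hu : IsStarProjection u) :
    (∀ p₁ p₂ : 𝔓.P 1, IsMinProj p₁ → IsMinProj p₂ →
      𝔓.gen.swap.tr 𝔓.trMinus 2 (u * 𝔓.barTensor p₁ p₂) ≠ 0) ↔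
    ∀ p₁ p₂ : 𝔓.P 1, IsMinProj p₁ → IsMinProj p₂ → u * 𝔓.barTensor p₁ p₂ ≠ 0 := by
  refine forall_congr' fun p₁ => forall_congr' fun p₂ => forall_congr' fun h₁ =>
    forall_congr' fun h₂ => ?_
  exact (𝔓.isCStar_minus.isFaithfulTrace_two.map_mul_eq_zero_iff hu
    (isStarProjection_barTensor h₁.1 h₂.1)).not

lemma barTensor_ne_zero {p q : 𝔓.P 1} (hp : IsStarProjection p) (hq : IsStarProjection q)
    (h : 𝔓.trPlus (𝔓.gen.closure 1 p * 𝔓.gen.closure 1 q) ≠ 0) : 𝔓.barTensor p q ≠ 0 := by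
  intro h0
  have h1 := (trace_convMap_eq_zero_iff (IsStarProjection.one (R := 𝔓.N 2)).isPos hp hq).2
    (by rw [h0, mul_zero])
  rw [convMap_apply] at h1
  exact h ((congrArg (𝔓.gen.evalZero 𝔓.trPlus) (𝔓.gen.cl_comp_convLeft_id p q)).symm.trans h1)

/-- The closures are scalars `c` and `d`, and the trace of their product is `c d τ(1)`. Faithfulness
of the 1-box trace makes `c τ(1)` and `d τ(1)` nonzero. -/
lemma trPlus_closure_mul_closure_ne_zero (hd : Module.finrank ℂ (𝔓.P 0) = 1) {p q : 𝔓.P 1}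
    (hp : IsStarProjection p) (hp0 : p ≠ 0) (hq : IsStarProjection q) (hq0 : q ≠ 0) :
    𝔓.trPlus (𝔓.gen.closure 1 p * 𝔓.gen.closure 1 q) ≠ 0 := by
  have hnt : Nontrivial (𝔓.P 0) := Module.nontrivial_of_finrank_pos (R := ℂ) (by omega)
  obtain ⟨c, hc⟩ := (finrank_eq_one_iff_of_nonzero' (1 : 𝔓.P 0) one_ne_zero).1 hd
    (𝔓.gen.closure 1 p)
  obtain ⟨d, hd⟩ := (finrank_eq_one_iff_of_nonzero' (1 : 𝔓.P 0) one_ne_zero).1 hd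
    (𝔓.gen.closure 1 q)
  have h1 : 𝔓.trPlus (𝔓.gen.closure 1 p) ≠ 0 := (𝔓.isFaithfulTrace_τ₁.pos_of_isPos hp.isPos hp0).ne'
  have h2 : 𝔓.trPlus (𝔓.gen.closure 1 q) ≠ 0 := (𝔓.isFaithfulTrace_τ₁.pos_of_isPos hq.isPos hq0).ne'
  rw [← hc, map_smul, smul_eq_mul] at h1
  rw [← hd, map_smul, smul_eq_mul] at h2
  rw [← hc, ← hd, smul_mul_smul_comm, mul_one, map_smul, smul_eq_mul]
  exact mul_ne_zero (mul_ne_zero (left_ne_zero_of_mul h1) (left_ne_zero_of_mul h2))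
    (right_ne_zero_of_mul h1)

end CStarPlanarAlgebra

end Diagrams

theorem theorem3p3 {B : Type u} [Bicategory.{w, v} B]
    [∀ a b : B, Preadditive (a ⟶ b)] [∀ a b : B, Linear ℂ (a ⟶ b)] [StarBicategory B]
    (𝔓 : CStarPlanarAlgebra B) (x : 𝔓.P 2) (hx : 𝔓.IsFPositive x) :
    ((𝔓.convSupport x = 1 ∧ Module.finrank ℂ (𝔓.P 0) = 1) →
      (𝔓.convSupport x = 1 ∧ ∀ p₁ p₂ : 𝔓.P 1, IsMinProj p₁ → IsMinProj p₂ →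
        𝔓.trPlus (𝔓.gen.closure 1 p₁ * 𝔓.gen.closure 1 p₂) ≠ 0)) ∧
    ((𝔓.convSupport x = 1 ∧ ∀ p₁ p₂ : 𝔓.P 1, IsMinProj p₁ → IsMinProj p₂ →
        𝔓.trPlus (𝔓.gen.closure 1 p₁ * 𝔓.gen.closure 1 p₂) ≠ 0) →
      ∀ p₁ p₂ : 𝔓.P 1, IsMinProj p₁ → IsMinProj p₂ →
        𝔓.convSupport x * 𝔓.barTensor p₁ p₂ ≠ 0) ∧
    List.TFAE [
      ∀ p₁ p₂ : 𝔓.P 1, IsMinProj p₁ → IsMinProj p₂ →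
        𝔓.convSupport x * 𝔓.barTensor p₁ p₂ ≠ 0,
      ∀ p₁ p₂ : 𝔓.P 1, IsMinProj p₁ → IsMinProj p₂ →
        𝔓.gen.swap.tr 𝔓.trMinus 2 (𝔓.convSupport x * 𝔓.barTensor p₁ p₂) ≠ 0,
      ∀ p : 𝔓.P 1, IsStarProjection p → p ≠ 0 →
        rangeProj (𝔓.conv12 p (𝔓.convSupport x)) = 1,
      𝔓.IsIrreducible x,
      ∀ p : 𝔓.P 1, IsStarProjection p → p ≠ 0 →
        IsStrictlyPos (𝔓.conv12 p
          (𝔓.pow (𝔓.e₁ + 𝔓.hat x) (Module.finrank ℂ (𝔓.P 1) - 1))),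
      -- the same with the unit of the convolution in place of the Jones projection
      ∀ p : 𝔓.P 1, IsStarProjection p → p ≠ 0 →
        IsStrictlyPos (𝔓.conv12 p
          (𝔓.pow (𝔓.unit + 𝔓.hat x) (Module.finrank ℂ (𝔓.P 1) - 1))),
      ∀ y₁ y₂ : 𝔓.P 1, IsPos y₁ → IsPos y₂ → y₁ ≠ 0 → y₂ ≠ 0 → 𝔓.inner y₁ y₂ = 0 →
        ∃ k : ℕ, k < Module.finrank ℂ (𝔓.P 1) ∧
          0 < 𝔓.inner (𝔓.conv12 y₁ (𝔓.pow (𝔓.hat x) k)) y₂,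
      ∀ q : 𝔓.N 1, IsStarProjection q →
        ∀ c : ℝ, 0 < c → PosLE (𝔓.conv21 (𝔓.hat x) q) ((c : ℂ) • q) → q = 0 ∨ q = 1] := by
  have hB := (CStarPlanarAlgebra.convSupport_spec hx).1
  refine ⟨fun ⟨h1, h2⟩ => ⟨h1, fun p₁ p₂ hp₁ hp₂ =>
    CStarPlanarAlgebra.trPlus_closure_mul_closure_ne_zero h2 hp₁.1 hp₁.2.1 hp₂.1 hp₂.2.1⟩,
    fun ⟨h1, h2⟩ p₁ p₂ hp₁ hp₂ => ?_, ?_⟩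
  · rw [h1, one_mul]
    exact CStarPlanarAlgebra.barTensor_ne_zero hp₁.1 hp₂.1 (h2 p₁ p₂ hp₁ hp₂)
  · rw [CStarPlanarAlgebra.tr_mul_barTensor_ne_zero_iff hB,
      CStarPlanarAlgebra.mul_barTensor_ne_zero_iff hx,
      CStarPlanarAlgebra.rangeProj_conv12_iff hB.isPos,
      CStarPlanarAlgebra.isStrictlyPos_e₁_iff_unit hx,
      ← CStarPlanarAlgebra.isIrreducibleMap_iff_unit hx,
      ← CStarPlanarAlgebra.isIrreducibleMap_iff_inner hx,
      ← CStarPlanarAlgebra.isIrreducibleMap_iff_conv21 hx,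
      CStarPlanarAlgebra.dominated_one_convSupport_iff hx,
      CStarPlanarAlgebra.isIrreducible_iff]
    -- Every entry of the list has been rewritten to the irreducibility of `T`.
    exact List.tfae_of_forall (IsIrreducibleMap (𝔓.convMap (𝔓.hat x))) _ (by simp)
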